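/- Let $N\ge 1$, $t\ge 0$ and $q=e^{-t/(2N)}$. Let $x_1(t),\dots,x_N(t)$ be the eigenvalue angles of Dyson Brownian motion on $U(N)$ started from the identity, i.e. the law of the angles is a weak solution (tested against smooth symmetric functions that are $2\pi$-periodic in each variable; no coincident eigenvalues for $t>0$) of the Fokker–Planck equation $$\frac{\partial p}{\partial t}=\frac1N\sum_{j=1}^N\frac{\partial}{\partial x_j}\Big(\frac{\partial W}{\partial x_j}+\frac12\frac{\partial}{\partial x_j}\Big)p,\qquad W=-\sum_{1\le j<k\le N}\log|e^{ix_k}-e^{ix_j}|,$$ with initial condition a unit mass at $x=0$. Let $\langle\cdot\rangle$ be the average over this law and, for an integer $k\ge0$, $$S_N(k;t)=\Big\langle\sum_{l,l'=1}^N e^{ik(x_l(t)-x_{l'}(t))}\Big\rangle-\Big\langle\sum_{l=1}^N e^{ikx_l(t)}\Big\rangle\Big\langle\sum_{l=1}^N e^{-ikx_l(t)}\Big\rangle .$$ For integers $j,l$ define $$a_j=\frac{(-1)^jq^{-(j-(N-1)/2)^2}}{\Gamma(N-j)\,\Gamma(j+1)},\qquad b_l=\frac{\Gamma(N-l)}{\Gamma(-l)}\,q^{(l-(N-1)/2)^2},$$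 where $1/\Gamma$ is $0$ at the poles of $\Gamma$, and $\Gamma(N-l)/\Gamma(-l)$ is understood as its limiting value $\prod_{i=0}^{N-1}(i-l)$. Then $a_j\ne0$ if and only if $0\le j\le N-1$, $b_l\neq0$ if and only if $l\notin\{0,\dots,N-1\}$, and for every integer $k\ge 0$ $$S_N(k;t)=\min(k,N)+\sum_{j=0}^{\min(k-1,N)}\ \sum_{l=\max(k,N)}^{N+k-1}\frac{a_j\,b_{j-k}\,a_{l-k}\,b_l}{(j-l)^2}.$$ The same formula holds for $t>0$ when $\langle\cdot\rangle$ is the average over $[-\pi,\pi]^N$ against the explicit eigenvalue density $$p_t(x)=\frac{q^{-N(N^2-1)/12}}{(2\pi)^N\prod_{l=1}^N l!}\Big(\prod_{1\le j<k\le N}\sin\frac{x_k-x_j}{2}\Big)\det\Big[\Big(-2\frac{\partial}{\partial x_j}\Big)^{k-1}\theta_\kappa(x_j/2;q)\Big]_{j,k=1}^N,$$ with $\kappa=2$ for $N$ even, $\kappa=3$ for $N$ odd, $\theta_2(z;q)=\sum_{n\in\mathbb Z}q^{(n-1/2)^2}e^{2iz(n-1/2)}$ and $\theta_3(z;q)=\sum_{n\in\mathbb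 Z}q^{n^2}e^{2izn}$. -/

import Mathlib

open Filter Topology MeasureTheory
open scoped ContDiff

noncomputable section

/-- `q = e^{-t/(2N)}`. -/
def dysonQ (N : ℕ) (t : ℝ) : ℝ := Real.exp (-t / (2 * N))

/-- The average `⟨f⟩` of an observable of `N` angles enters only through the functional `E`;
`S(k) = ⟨∑_{l,l'} e^{ik(x_l - x_{l'})}⟩ - ⟨∑_l e^{ikx_l}⟩ ⟨∑_l e^{-ikx_l}⟩`. -/
def spectralFormFactor {N : ℕ} (E : ((Fin N → ℝ) → ℂ) → ℂ) (k : ℤ) : ℂ :=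
  E (fun x => ∑ l, ∑ l', Complex.exp (Complex.I * k * (x l - x l')))
    - E (fun x => ∑ l, Complex.exp (Complex.I * k * x l))
      * E (fun x => ∑ l, Complex.exp (-(Complex.I * k * x l)))

/-! ### Dyson Brownian motion from the identity, via its Fokker-Planck equation -/

/-- The partial derivative in the `j`-th coordinate. -/
def partialDeriv {N : ℕ} {F : Type*} [NormedAddCommGroup F] [NormedSpace ℝ F]
    (j : Fin N) (f : (Fin N → ℝ) → F) (x : Fin N → ℝ) : F :=
  deriv (fun s => f (Function.update x j s)) (x j)

/-- The potential `W = -∑_{j<k} log |e^{ix_k} - e^{ix_j}|`. -/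
def dysonPotential (N : ℕ) (x : Fin N → ℝ) : ℝ :=
  -∑ j, ∑ k ∈ Finset.Ioi j,
    Real.log ‖Complex.exp (Complex.I * x k) - Complex.exp (Complex.I * x j)‖

/-- The adjoint `∑_j (-(∂_j W) ∂_j + (1/β) ∂_j²)`, at `β = 2`, of the Fokker-Planck operator
`∑_j ∂_j ((∂_j W) + (1/β) ∂_j)`. -/
def dysonGenerator (N : ℕ) (f : (Fin N → ℝ) → ℂ) (x : Fin N → ℝ) : ℂ :=
  ∑ j, (-((partialDeriv j (dysonPotential N) x : ℝ) : ℂ) * partialDeriv j f x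
    + (1 / 2) * partialDeriv j (partialDeriv j f) x)

/-- Smooth symmetric functions of `N` angles. -/
structure IsAngleTestFunction (N : ℕ) (f : (Fin N → ℝ) → ℂ) : Prop where
  smooth : ContDiff ℝ ∞ f
  periodic : ∀ (j : Fin N) (x : Fin N → ℝ), f (Function.update x j (x j + 2 * Real.pi)) = f x
  symmetric : ∀ (σ : Equiv.Perm (Fin N)) (x : Fin N → ℝ), f (x ∘ σ) = f x

/-- `μ t` is the law at the (scaled) time `t` of the eigenvalue angles (labelled in any way) of
Dyson Brownian motion on `U(N)` from the identity: a weak solution of the Fokker-Planck equation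
`∂p/∂t = (1/N) 𝓛 p` with initial condition a unit mass at `x = 0`, without coincident eigenvalues
at positive times. -/
structure IsDysonLaw (N : ℕ) (μ : ℝ → Measure (Fin N → ℝ)) : Prop where
  initial : μ 0 = Measure.dirac 0
  prob : ∀ t, 0 < t → IsProbabilityMeasure (μ t)
  noncolliding : ∀ t, 0 < t → ∀ᵐ x ∂μ t,
    Function.Injective fun j : Fin N => Complex.exp (Complex.I * x j)
  weakEq : ∀ f, IsAngleTestFunction N f → ∀ t, 0 < t →
    HasDerivAt (fun s => ∫ x, f x ∂μ s) ((1 / N : ℂ) * ∫ x, dysonGenerator N f x ∂μ t) t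
  tendsto_initial : ∀ f, IsAngleTestFunction N f →
    Tendsto (fun s => ∫ x, f x ∂μ s) (𝓝[>] 0) (𝓝 (f 0))

/-! ### The explicit eigenvalue density -/

def theta2 (z : ℂ) (q : ℝ) : ℂ :=
  ∑' n : ℤ, ((q ^ (((n : ℝ) - 1 / 2) ^ 2) : ℝ) : ℂ)
    * Complex.exp (2 * Complex.I * z * ((n : ℂ) - 1 / 2))

def theta3 (z : ℂ) (q : ℝ) : ℂ :=
  ∑' n : ℤ, ((q ^ ((n : ℝ) ^ 2) : ℝ) : ℂ) * Complex.exp (2 * Complex.I * z * n)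

/-- `x ↦ θ_κ(x/2; q)`, with `κ = 2` for `N` even and `κ = 3` for `N` odd. -/
def thetaHalf (N : ℕ) (q : ℝ) (x : ℝ) : ℂ :=
  if Even N then theta2 ((x : ℂ) / 2) q else theta3 ((x : ℂ) / 2) q

/-- The eigenvalue probability density (its values are real numbers, regarded as elements of `ℂ`)
`q^{-N(N²-1)/12} / ((2π)^N ∏_{l=1}^N l!) ∏_{j<k} sin((x_k-x_j)/2)`
`× det [(-2 ∂/∂x_j)^{k-1} θ_κ(x_j/2; q)]_{j,k=1,…,N}` on `[-π,π]^N`. -/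
def dysonDensity (N : ℕ) (t : ℝ) (x : Fin N → ℝ) : ℂ :=
  ((dysonQ N t ^ (-((N : ℝ) * ((N : ℝ) ^ 2 - 1) / 12))
      / ((2 * Real.pi) ^ N * ∏ l ∈ Finset.Icc 1 N, (l.factorial : ℝ)) : ℝ) : ℂ)
    * ((∏ j, ∏ k ∈ Finset.Ioi j, Real.sin ((x k - x j) / 2) : ℝ) : ℂ)
    * (Matrix.of fun j k : Fin N =>
        (-2 : ℂ) ^ (k : ℕ) * iteratedDeriv (k : ℕ) (thetaHalf N (dysonQ N t)) (x j)).det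

/-- The average over the angles in `[-π,π]^N` with respect to the explicit density. -/
def dysonAverage (N : ℕ) (t : ℝ) (f : (Fin N → ℝ) → ℂ) : ℂ :=
  ∫ x in Set.Icc (fun _ : Fin N => -Real.pi) (fun _ => Real.pi), f x * dysonDensity N t x

/-! ### The coefficients -/

/-- `Γ(N-u)/Γ(-u)`, extended continuously to all real `u`: the rising factorial
`(-u)(-u+1)⋯(-u+N-1)`. -/
def gammaRatio (N : ℕ) (u : ℝ) : ℝ := (ascPochhammer ℝ N).eval (-u)

theorem gammaRatio_eq (N : ℕ) (u : ℝ) (hu : ∀ m : ℕ, u ≠ m) :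
    Real.Gamma (N - u) / Real.Gamma (-u) = gammaRatio N u := by
  have h0 : Real.Gamma (-u) ≠ 0 := Real.Gamma_ne_zero fun m h => hu m (by linarith)
  rw [div_eq_iff h0, gammaRatio]
  induction N with
  | zero => simp
  | succ n ih =>
    have h1 : (n : ℝ) - u ≠ 0 := fun h => hu n (by linarith)
    have h2 : ((n + 1 : ℕ) : ℝ) - u = ((n : ℝ) - u) + 1 := by push_cast; ring
    rw [h2, Real.Gamma_add_one h1, ih, ascPochhammer_succ_eval]
    ring

theorem tendsto_gammaRatio (N : ℕ) (l : ℤ) :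
    Tendsto (fun u : ℝ => Real.Gamma (N - u) / Real.Gamma (-u)) (𝓝[≠] (l : ℝ))
      (𝓝 (gammaRatio N l)) := by
  have hc : Continuous (gammaRatio N) := by unfold gammaRatio; fun_prop
  refine (hc.continuousAt.mono_left nhdsWithin_le_nhds).congr' ?_
  have hb : ∀ᶠ u : ℝ in 𝓝[≠] (l : ℝ), u ∈ Metric.ball (l : ℝ) 1 :=
    nhdsWithin_le_nhds (Metric.ball_mem_nhds _ one_pos)
  filter_upwards [hb, self_mem_nhdsWithin] with u hu hne
  refine (gammaRatio_eq N u fun m hm => hne ?_).symm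
  subst hm
  have h := abs_lt.1 (by simpa [Real.dist_eq] using hu : |(m : ℝ) - l| < 1)
  have h1 : (m : ℤ) - l < 1 := by exact_mod_cast h.2
  have h2 : -1 < (m : ℤ) - l := by exact_mod_cast h.1
  have h3 : (m : ℤ) = l := by omega
  show (m : ℝ) = l
  exact_mod_cast h3

/-- `a_j = (-1)^j q^{-(j-(N-1)/2)²} / (Γ(N-j) Γ(j+1))`; here `1/Γ` vanishes at the poles of `Γ`,
in accordance with `Real.Gamma` and division by zero. -/
def coeffA (N : ℕ) (t : ℝ) (j : ℤ) : ℝ :=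
  (-1 : ℝ) ^ j * dysonQ N t ^ (-((j : ℝ) - ((N : ℝ) - 1) / 2) ^ 2)
    / (Real.Gamma ((N : ℝ) - j) * Real.Gamma ((j : ℝ) + 1))

/-- `b_l = (Γ(N-l)/Γ(-l)) q^{(l-(N-1)/2)²}`. -/
def coeffB (N : ℕ) (t : ℝ) (l : ℤ) : ℝ :=
  gammaRatio N l * dysonQ N t ^ (((l : ℝ) - ((N : ℝ) - 1) / 2) ^ 2)

/-- `min(k,N) + ∑_{j=0}^{min(k-1,N)} ∑_{l=max(k,N)}^{N+k-1} a_j b_{j-k} a_{l-k} b_l / (j-l)²`. -/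
def formFactorSum (N : ℕ) (t : ℝ) (k : ℕ) : ℝ :=
  (min k N : ℕ) + ∑ j ∈ Finset.Icc (0 : ℤ) (min ((k : ℤ) - 1) N),
    ∑ l ∈ Finset.Icc (max (k : ℤ) N) ((N : ℤ) + k - 1),
      coeffA N t j * coeffB N t (j - k) * coeffA N t (l - k) * coeffB N t l
        / ((j : ℝ) - l) ^ 2

end

/-! Both averages are diagonal on the characters of U(N), the quotients of the alternant with
exponents `n j - (N-1)/2` by the one with `n = (0, …, N-1)`. For either average, the mean of a
character is its value at the identity (a ratio of Vandermonde determinants) times `q` to the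
difference of the sums of squared exponents: this is `charAverage`. For Dyson Brownian motion,
conjugation by the denominator alternant turns the generator into half the Laplacian minus a
constant (`dysonGenerator_character`), so the mean solves a linear ODE. For the explicit density,
the sine product is the denominator alternant up to a constant, and Andréief's identity yields a
determinant of Fourier coefficients of theta (`integral_alternant_mul_thetaDet`). Multiplying an
alternant by a power sum shifts one exponent at a time (`powerSum_mul_alternant`), so only weights
differing from `0, …, N-1` in at most two places occur (`spectralFormFactor_eq`). By Lagrange
interpolation their averages are single entries or 2×2 minors of `transferCoeff`. In the form factor
the product of means cancels the main terms of the minors, leaving `N` minus a sum of products of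
two transfer coefficients. Explicitly, an off-diagonal coefficient is `-a_l b_u / (u - l)`
(`transferCoeff_eq`); the diagonal ones equal 1 and account for `min(k, N)` (`formFactor_identity`).
-/

/-! ### Vanishing of the coefficients. -/

theorem dysonQ_pos (N : ℕ) (t : ℝ) : 0 < dysonQ N t := Real.exp_pos _

theorem gammaRatio_eq_prod (N : ℕ) (u : ℝ) :
    gammaRatio N u = ∏ i ∈ Finset.range N, ((i : ℝ) - u) := by
  unfold gammaRatio
  induction N with
  | zero => simp
  | succ n ih => rw [ascPochhammer_succ_eval, ih, Finset.prod_range_succ]; ring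

theorem coeffB_ne_zero_iff (N : ℕ) (t : ℝ) (l : ℤ) :
    coeffB N t l ≠ 0 ↔ ¬(0 ≤ l ∧ l ≤ (N : ℤ) - 1) := by
  have h := (Real.rpow_pos_of_pos (dysonQ_pos N t) (((l : ℝ) - ((N : ℝ) - 1) / 2) ^ 2)).ne'
  rw [coeffB, mul_ne_zero_iff, and_iff_left h, gammaRatio_eq_prod, Finset.prod_ne_zero_iff]
  constructor
  · rintro h1 ⟨h2, h3⟩
    obtain ⟨m, rfl⟩ := Int.eq_ofNat_of_zero_le h2
    exact h1 m (Finset.mem_range.2 (by omega)) (by simp)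
  · intro h1 i hi h2
    have h3 : (i : ℤ) = l := by exact_mod_cast sub_eq_zero.1 h2
    have := Finset.mem_range.1 hi
    omega

/-- `Real.Gamma` takes the value 0 at its poles and nowhere else, so division by zero makes the
quotient vanish exactly when `N - j` or `j + 1` is a nonpositive integer. -/
theorem coeffA_ne_zero_iff (N : ℕ) (t : ℝ) (j : ℤ) :
    coeffA N t j ≠ 0 ↔ 0 ≤ j ∧ j ≤ (N : ℤ) - 1 := by
  have h := (Real.rpow_pos_of_pos (dysonQ_pos N t) (-((j : ℝ) - ((N : ℝ) - 1) / 2) ^ 2)).ne'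
  have h' : (-1 : ℝ) ^ j ≠ 0 := zpow_ne_zero _ (by norm_num)
  rw [coeffA, div_ne_zero_iff, and_iff_right (mul_ne_zero h' h), mul_ne_zero_iff]
  simp only [ne_eq, Real.Gamma_eq_zero_iff, not_exists]
  constructor
  · rintro ⟨h1, h2⟩
    by_contra hc
    rw [not_and_or] at hc
    rcases hc with hc | hc
    · refine h2 (-(j + 1)).toNat ?_
      have : (((-(j + 1)).toNat : ℤ) : ℝ) = ((-(j + 1) : ℤ) : ℝ) := by
        rw [Int.toNat_of_nonneg (by omega)]
      rw [Int.cast_natCast] at this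
      rw [this]; push_cast; ring
    · refine h1 (j - N).toNat ?_
      have : (((j - N).toNat : ℤ) : ℝ) = ((j - N : ℤ) : ℝ) := by
        rw [Int.toNat_of_nonneg (by omega)]
      rw [Int.cast_natCast] at this
      rw [this]; push_cast; ring
  · rintro ⟨h1, h2⟩
    refine ⟨fun m hm => ?_, fun m hm => ?_⟩
    · have : (N : ℤ) - j = -m := by exact_mod_cast hm
      omega
    · have : j + 1 = -(m : ℤ) := by exact_mod_cast hm
      omega

/-! ### Character averages and the finite determinantal identity. -/

/-- The Vandermonde determinant of `n`, normalised by its value at `0, 1, …, N-1`. -/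
noncomputable def vandermondeRatio (N : ℕ) (n : Fin N → ℤ) : ℝ :=
  (Matrix.vandermonde fun i => (n i : ℝ)).det
    / (Matrix.vandermonde fun i : Fin N => ((i : ℕ) : ℝ)).det

/-- The average at time `t` of the character with shifted highest weight `n`. -/
noncomputable def charAverage (N : ℕ) (t : ℝ) (n : Fin N → ℤ) : ℝ :=
  vandermondeRatio N n * dysonQ N t ^
    (∑ j, (((n j : ℝ) - ((N : ℝ) - 1) / 2) ^ 2 - (((j : ℕ) : ℝ) - ((N : ℝ) - 1) / 2) ^ 2))

/-- The shifted highest weight `0, 1, …, N-1` of the trivial character. -/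
def trivialWeight (N : ℕ) : Fin N → ℤ := fun i => (i : ℕ)

/-- The Lagrange basis polynomial at the nodes `0, 1, …, N-1`. -/
noncomputable def lagrangeVal (N : ℕ) (j : Fin N) (u : ℤ) : ℝ :=
  (Lagrange.basis Finset.univ (fun i : Fin N => ((i : ℕ) : ℝ)) j).eval (u : ℝ)

/-- The average of the character whose weight is `0, …, N-1` with the entry `j` replaced by `u`; see
`charAverage_update`. -/
noncomputable def transferCoeff (N : ℕ) (t : ℝ) (j : Fin N) (u : ℤ) : ℝ :=
  lagrangeVal N j u * dysonQ N t ^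
    (((u : ℝ) - ((N : ℝ) - 1) / 2) ^ 2 - (((j : ℕ) : ℝ) - ((N : ℝ) - 1) / 2) ^ 2)

theorem natCast_fin_injective (N : ℕ) : Function.Injective fun i : Fin N => ((i : ℕ) : ℝ) :=
  fun i j h => Fin.ext (by simpa using h)

theorem vandermonde_nodes_ne_zero (N : ℕ) :
    (Matrix.vandermonde fun i : Fin N => ((i : ℕ) : ℝ)).det ≠ 0 :=
  Matrix.det_vandermonde_ne_zero_iff.2 (natCast_fin_injective N)

theorem lagrangeVal_eq (N : ℕ) (j : Fin N) (u : ℤ) :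
    lagrangeVal N j u = ∏ i ∈ Finset.univ.erase j,
      (((u : ℝ) - (i : ℕ)) / (((j : ℕ) : ℝ) - (i : ℕ))) := by
  simp only [lagrangeVal, Lagrange.basis, Lagrange.basisDivisor, Polynomial.eval_prod,
    Polynomial.eval_mul, Polynomial.eval_sub, Polynomial.eval_X, Polynomial.eval_C]
  exact Finset.prod_congr rfl fun i _ => by rw [div_eq_inv_mul]

/-- Interpolation at `N` nodes is exact on `X ^ a` for `a < N`. Thus the Lagrange values are the
coordinates of a new Vandermonde row in the basis of the old rows, as Cramer's rule requires. -/
theorem powers_eq_sum_lagrangeVal (N : ℕ) (u : ℤ) :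
    (fun a : Fin N => (u : ℝ) ^ (a : ℕ)) =
      ∑ i, lagrangeVal N i u • Matrix.vandermonde (fun i : Fin N => ((i : ℕ) : ℝ)) i := by
  funext a
  have h := Lagrange.eq_interpolate (s := Finset.univ) (v := fun i : Fin N => ((i : ℕ) : ℝ))
    (f := (Polynomial.X : Polynomial ℝ) ^ (a : ℕ)) (natCast_fin_injective N).injOn (by
      rw [Polynomial.degree_X_pow]; simp)
  have h2 := congrArg (Polynomial.eval (u : ℝ)) h
  simp only [Polynomial.eval_pow, Polynomial.eval_X, Lagrange.interpolate_apply,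
    Polynomial.eval_finsetSum, Polynomial.eval_mul, Polynomial.eval_C] at h2
  rw [h2, Finset.sum_apply]
  refine Finset.sum_congr rfl fun i _ => ?_
  simp [lagrangeVal, Matrix.vandermonde_apply, mul_comm]

theorem vandermonde_update {R : Type*} [CommRing R] (N : ℕ) (v : Fin N → R) (j : Fin N) (u : R) :
    Matrix.vandermonde (Function.update v j u) =
      (Matrix.vandermonde v).updateRow j (fun a => u ^ (a : ℕ)) := by
  ext i a
  by_cases h : i = j
  · subst h; simp [Matrix.vandermonde_apply]
  · simp [Matrix.vandermonde_apply, Matrix.updateRow_ne h, Function.update_of_ne h]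

theorem intCast_update {N : ℕ} (n : Fin N → ℤ) (j : Fin N) (u : ℤ) :
    (fun i => ((Function.update n j u i : ℤ) : ℝ)) =
      Function.update (fun i => (n i : ℝ)) j (u : ℝ) := by
  funext i
  by_cases h : i = j
  · subst h; simp
  · simp [Function.update_of_ne h]

theorem vandermondeRatio_update (N : ℕ) (j : Fin N) (u : ℤ) :
    vandermondeRatio N (Function.update (trivialWeight N) j u) = lagrangeVal N j u := by
  rw [vandermondeRatio, div_eq_iff (vandermonde_nodes_ne_zero N), intCast_update,
    vandermonde_update, powers_eq_sum_lagrangeVal]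
  exact Matrix.det_updateRow_sum (Matrix.vandermonde fun i : Fin N => ((i : ℕ) : ℝ)) j _

/-- Expanding row `l`, a summand `A k` with `k ≠ j, l` repeats an existing row. Only `A l` and `A j`
contribute, the latter with the sign of a row swap. -/
theorem Matrix.det_updateRow_updateRow_sum {n R : Type*} [DecidableEq n] [Fintype n] [CommRing R]
    (A : Matrix n n R) {j l : n} (hjl : j ≠ l) (c d : n → R) :
    ((A.updateRow j (∑ k, c k • A k)).updateRow l (∑ k, d k • A k)).det =
      (c j * d l - c l * d j) * A.det := by
  have key : ∀ B : Matrix n n R, (B.updateRow l (∑ k, d k • A k)).det =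
      ∑ k, d k * (B.updateRow l (A k)).det := by
    intro B
    have := Matrix.detRowAlternating.map_update_sum (R := R) Finset.univ l
      (fun k => d k • A k) B
    refine this.trans (Finset.sum_congr rfl fun k _ => ?_)
    exact Matrix.detRowAlternating.map_update_smul B l (d k) (A k)
  rw [key, ← Finset.add_sum_erase _ _ (Finset.mem_univ l),
    ← Finset.add_sum_erase _ _ (Finset.mem_erase.2 ⟨hjl, Finset.mem_univ j⟩)]
  have h0 : ∀ k ∈ (Finset.univ.erase l).erase j,
      d k * ((A.updateRow j (∑ k, c k • A k)).updateRow l (A k)).det = 0 := by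
    intro k hk
    simp only [Finset.mem_erase, Finset.mem_univ, and_true] at hk
    rw [Matrix.det_zero_of_row_eq hk.2 (by
      rw [Matrix.updateRow_ne hk.2, Matrix.updateRow_ne hk.1, Matrix.updateRow_self]), mul_zero]
  rw [Finset.sum_eq_zero h0]
  have h1 : ((A.updateRow j (∑ k, c k • A k)).updateRow l (A l)).det = c j * A.det := by
    rw [← smul_eq_mul, ← Matrix.det_updateRow_sum]
    congr 1
    have := Matrix.updateRow_eq_self (A.updateRow j (∑ k, c k • A k)) l
    rwa [Matrix.updateRow_ne hjl.symm] at this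
  have h2 : ((A.updateRow j (∑ k, c k • A k)).updateRow l (A j)).det = -(c l * A.det) := by
    rw [← smul_eq_mul, ← Matrix.det_updateRow_sum A l c]
    have := Matrix.det_permute (Equiv.swap j l) (A.updateRow l (∑ k, c k • A k))
    rw [Equiv.Perm.sign_swap hjl] at this
    simp only [Units.val_neg, Units.val_one, Int.cast_neg, Int.cast_one, neg_mul, one_mul] at this
    rw [← this]
    congr 1
    ext i a
    by_cases hil : i = l
    · subst hil; simp [Matrix.updateRow_ne hjl]
    · by_cases hij : i = j
      · subst hij; simp [Matrix.updateRow_ne hjl]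
      · simp [Matrix.updateRow_ne hil, Matrix.updateRow_ne hij, Equiv.swap_apply_of_ne_of_ne hij hil]
  rw [h1, h2]; ring

theorem vandermondeRatio_update_update (N : ℕ) {j l : Fin N} (hjl : j ≠ l) (u v : ℤ) :
    vandermondeRatio N (Function.update (Function.update (trivialWeight N) j u) l v) =
      lagrangeVal N j u * lagrangeVal N l v - lagrangeVal N l u * lagrangeVal N j v := by
  rw [vandermondeRatio, div_eq_iff (vandermonde_nodes_ne_zero N), intCast_update, intCast_update,
    vandermonde_update, vandermonde_update, powers_eq_sum_lagrangeVal, powers_eq_sum_lagrangeVal]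
  exact Matrix.det_updateRow_updateRow_sum (Matrix.vandermonde fun i : Fin N => ((i : ℕ) : ℝ))
    hjl _ _

theorem charAverage_trivialWeight (N : ℕ) (t : ℝ) : charAverage N t (trivialWeight N) = 1 := by
  have : vandermondeRatio N (trivialWeight N) = 1 := by
    rw [vandermondeRatio, div_eq_one_iff_eq (vandermonde_nodes_ne_zero N)]
    simp [trivialWeight]
  simp [charAverage, this, trivialWeight]

theorem charAverage_update (N : ℕ) (t : ℝ) (j : Fin N) (u : ℤ) :
    charAverage N t (Function.update (trivialWeight N) j u) = transferCoeff N t j u := by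
  rw [charAverage, transferCoeff, vandermondeRatio_update, Finset.sum_eq_single j]
  · simp
  · intro i _ hi
    simp [Function.update_of_ne hi, trivialWeight]
  · simp

theorem charAverage_update_update (N : ℕ) (t : ℝ) {j l : Fin N} (hjl : j ≠ l) (u v : ℤ) :
    charAverage N t (Function.update (Function.update (trivialWeight N) j u) l v) =
      transferCoeff N t j u * transferCoeff N t l v -
        transferCoeff N t l u * transferCoeff N t j v := by
  have hq := dysonQ_pos N t
  rw [charAverage, vandermondeRatio_update_update N hjl,
    ← Finset.add_sum_erase _ _ (Finset.mem_univ j),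
    ← Finset.add_sum_erase _ _ (Finset.mem_erase.2 ⟨hjl.symm, Finset.mem_univ l⟩),
    Finset.sum_eq_zero]
  · simp only [transferCoeff, Function.update_self, Function.update_of_ne hjl, add_zero, sub_mul]
    -- The total exponent of `q` is symmetric in `u` and `v`, so both products of the minor carry
    -- the same power.
    rw [mul_mul_mul_comm, ← Real.rpow_add hq, mul_mul_mul_comm, ← Real.rpow_add hq]
    congr 3
    ring
  · intro i hi
    simp only [Finset.mem_erase, Finset.mem_univ, and_true] at hi
    simp [Function.update_of_ne hi.1, Function.update_of_ne hi.2, trivialWeight]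

theorem transferCoeff_self (N : ℕ) (t : ℝ) (j : Fin N) : transferCoeff N t j (j : ℕ) = 1 := by
  have : lagrangeVal N j (j : ℕ) = 1 := by
    have := Lagrange.eval_basis_self (s := Finset.univ) (v := fun i : Fin N => ((i : ℕ) : ℝ))
      (i := j) (natCast_fin_injective N).injOn (Finset.mem_univ j)
    simpa [lagrangeVal] using this
  simp [transferCoeff, this]

/-- The denominator of the Lagrange basis polynomial at the node `l`; its factorials become the
Gamma functions of `a_l`. -/
theorem prod_erase_sub (N : ℕ) (l : Fin N) :
    ∏ i ∈ Finset.univ.erase l, (((l : ℕ) : ℝ) - (i : ℕ)) =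
      (-1) ^ (N - 1 - l) * ((N - 1 - l).factorial * (l : ℕ).factorial) := by
  obtain ⟨l, hl⟩ := l
  obtain ⟨m, rfl⟩ := Nat.exists_eq_add_of_le (Nat.succ_le_of_lt hl)
  have h1 : ∏ i ∈ Finset.univ.erase (⟨l, hl⟩ : Fin (l.succ + m)), ((l : ℝ) - (i : ℕ)) =
      ∏ i ∈ (Finset.range (l.succ + m)).erase l, ((l : ℝ) - i) := by
    refine Finset.prod_bij (fun i _ => (i : ℕ)) ?_ ?_ ?_ ?_
    · intro i hi
      simp only [Finset.mem_erase, Finset.mem_univ, and_true, Finset.mem_range] at hi ⊢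
      exact ⟨fun h => hi (Fin.ext h), i.2⟩
    · intro a _ b _ h; exact Fin.ext h
    · intro b hb
      simp only [Finset.mem_erase, Finset.mem_range] at hb
      exact ⟨⟨b, hb.2⟩, by simp [Fin.ext_iff, hb.1], rfl⟩
    · intros; rfl
  have h2 : (Finset.range (l.succ + m)).erase l =
      Finset.range l ∪ (Finset.range m).image (fun i => l.succ + i) := by
    ext i
    simp only [Finset.mem_erase, Finset.mem_range, Finset.mem_union, Finset.mem_image]
    constructor
    · rintro ⟨ha, hb⟩
      rcases lt_or_gt_of_ne ha with h | h
      · exact Or.inl h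
      · exact Or.inr ⟨i - l.succ, by omega, by omega⟩
    · rintro (h | ⟨b, hb, rfl⟩) <;> omega
  have h3 : ∏ i ∈ Finset.range l, ((l : ℝ) - i) = l.factorial := by
    rw [← Finset.prod_range_reflect, ← Finset.prod_range_add_one_eq_factorial]
    push_cast
    refine Finset.prod_congr rfl fun i hi => ?_
    have := Finset.mem_range.1 hi
    rw [Nat.cast_sub (by omega), Nat.cast_sub (by omega)]; push_cast; ring
  have h4 : ∏ i ∈ Finset.range m, ((l : ℝ) - ((l.succ + i : ℕ) : ℝ)) = (-1) ^ m * m.factorial := by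
    rw [← Finset.prod_range_add_one_eq_factorial]
    push_cast
    rw [← Finset.card_range m, ← Finset.prod_const, Finset.card_range, ← Finset.prod_mul_distrib]
    exact Finset.prod_congr rfl fun i _ => by ring
  have h5 : l.succ + m - 1 - l = m := by omega
  simp only [h5]
  rw [h1, h2, Finset.prod_union, Finset.prod_image, h3, h4]
  · ring
  · intro a _ b _ h; simpa using h
  · rw [Finset.disjoint_left]
    intro i hi h
    simp only [Finset.mem_range, Finset.mem_image] at hi h
    omega

/-- The numerator of the Lagrange basis polynomial is the full product over the nodes, that is
`gammaRatio` up to sign, with the factor `u - l` removed. Its denominator and the power of `q`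
attached to the node make up `a_l`. -/
theorem transferCoeff_eq (N : ℕ) (t : ℝ) (l : Fin N) {u : ℤ} (hu : u ≠ (l : ℕ)) :
    transferCoeff N t l u = -(coeffA N t (l : ℕ) * coeffB N t u / ((u : ℝ) - (l : ℕ))) := by
  have hq := dysonQ_pos N t
  have hul : (u : ℝ) - (l : ℕ) ≠ 0 := sub_ne_zero.2 (by exact_mod_cast hu)
  have hG : Real.Gamma ((N : ℝ) - ((l : ℕ) : ℤ)) * Real.Gamma ((((l : ℕ) : ℤ) : ℝ) + 1) =
      ((N - 1 - l).factorial * (l : ℕ).factorial : ℝ) := by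
    have h1 : (N : ℝ) - ((l : ℕ) : ℤ) = ((N - 1 - l : ℕ) : ℝ) + 1 := by
      have : (N : ℝ) = ((N - 1 - l + 1 + l : ℕ) : ℝ) := congrArg Nat.cast (by omega)
      rw [this]
      push_cast; ring
    rw [h1, Int.cast_natCast, Real.Gamma_nat_eq_factorial, Real.Gamma_nat_eq_factorial]
  have hB : gammaRatio N u = (-1) ^ N * (((u : ℝ) - (l : ℕ)) *
      ∏ i ∈ Finset.univ.erase l, ((u : ℝ) - (i : ℕ))) := by
    rw [gammaRatio_eq_prod,
      Finset.mul_prod_erase Finset.univ (fun i : Fin N => (u : ℝ) - (i : ℕ)) (Finset.mem_univ l),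
      ← Fin.prod_univ_eq_prod_range (fun i => (i : ℝ) - u)]
    have : ((-1 : ℝ)) ^ N = ∏ _i : Fin N, (-1 : ℝ) := by simp
    rw [this, ← Finset.prod_mul_distrib]
    exact Finset.prod_congr rfl fun i _ => by ring
  -- Reversing the `N` factors `i - u` and the sign of the denominator together leave `-(-1)^l`: the
  -- sign of `a_l` and the overall minus.
  have hs : (-1 : ℝ) ^ N = -((-1) ^ (N - 1 - (l : ℕ)) * (-1) ^ (l : ℕ)) := by
    have : N = (N - 1 - l) + l + 1 := by omega
    conv_lhs => rw [this]
    rw [pow_succ, pow_add]; ring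
  have hss : ((-1 : ℝ) ^ (l : ℕ)) * (-1) ^ (l : ℕ) = 1 := by
    rw [← mul_pow]; norm_num
  have hss' : ((-1 : ℝ) ^ (N - 1 - (l : ℕ))) * (-1) ^ (N - 1 - (l : ℕ)) = 1 := by
    rw [← mul_pow]; norm_num
  rw [transferCoeff, lagrangeVal_eq, Finset.prod_div_distrib, prod_erase_sub, coeffA, coeffB, hG,
    hB, hs, Int.cast_natCast, zpow_natCast, sub_eq_add_neg, Real.rpow_add hq]
  have f1 : ((N - 1 - (l : ℕ)).factorial : ℝ) ≠ 0 := by positivity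
  have f2 : ((l : ℕ).factorial : ℝ) ≠ 0 := by positivity
  have f3 : ((-1 : ℝ) ^ (N - 1 - (l : ℕ))) ≠ 0 := pow_ne_zero _ (by norm_num)
  generalize (-1 : ℝ) ^ (N - 1 - (l : ℕ)) = s at *
  generalize (-1 : ℝ) ^ (l : ℕ) = r at *
  generalize dysonQ N t ^ (-(((l : ℕ) : ℝ) - ((N : ℝ) - 1) / 2) ^ 2) = x
  generalize dysonQ N t ^ (((u : ℝ) - ((N : ℝ) - 1) / 2) ^ 2) = y
  generalize ∏ i ∈ Finset.univ.erase l, ((u : ℝ) - (i : ℕ)) = z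
  field_simp
  linear_combination -(x * y * z * s * s) * hss - x * y * z * hss'

theorem trivialWeight_add_single (N : ℕ) (j : Fin N) (k : ℤ) :
    trivialWeight N + Pi.single j k = Function.update (trivialWeight N) j ((j : ℕ) + k) := by
  funext i
  by_cases h : i = j
  · subst h; simp [trivialWeight]
  · simp [h]

theorem trivialWeight_add_single_add_single (N : ℕ) {j l : Fin N} (hjl : j ≠ l) (k k' : ℤ) :
    trivialWeight N + Pi.single j k + Pi.single l k' =
      Function.update (Function.update (trivialWeight N) j ((j : ℕ) + k)) l ((l : ℕ) + k') := by
  funext i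
  by_cases h : i = l
  · subst h; simp [trivialWeight, hjl.symm]
  · by_cases h' : i = j
    · subst h'; simp [trivialWeight, h]
    · simp [h, h']

theorem charAverage_sum_eq (N : ℕ) (t : ℝ) (k : ℕ) :
    ∑ j, ∑ l, charAverage N t (trivialWeight N + Pi.single j (k : ℤ) + Pi.single l (-(k : ℤ)))
      - (∑ j, charAverage N t (trivialWeight N + Pi.single j (k : ℤ)))
        * (∑ l, charAverage N t (trivialWeight N + Pi.single l (-(k : ℤ)))) =
    N - ∑ j : Fin N, ∑ l : Fin N, transferCoeff N t l ((j : ℕ) + k) *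
      transferCoeff N t j ((l : ℕ) + -(k : ℤ)) := by
  -- For `j = l` the two shifts cancel and the average is 1, while the minor is 0. A Kronecker delta
  -- therefore gives one formula for all pairs, and its sum is `N`.
  have h : ∀ j l : Fin N,
      charAverage N t (trivialWeight N + Pi.single j (k : ℤ) + Pi.single l (-(k : ℤ))) =
      (if j = l then 1 else 0) + (transferCoeff N t j ((j : ℕ) + k) *
        transferCoeff N t l ((l : ℕ) + -(k : ℤ)) -
          transferCoeff N t l ((j : ℕ) + k) * transferCoeff N t j ((l : ℕ) + -(k : ℤ))) := by
    intro j l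
    by_cases hjl : j = l
    · subst hjl
      rw [add_assoc, ← Pi.single_add, add_neg_cancel, Pi.single_zero, add_zero,
        charAverage_trivialWeight]
      simp
    · rw [trivialWeight_add_single_add_single N hjl, charAverage_update_update N t hjl, if_neg hjl,
        zero_add]
  simp only [h]
  simp only [trivialWeight_add_single, charAverage_update, Finset.sum_add_distrib,
    Finset.sum_sub_distrib, Finset.sum_mul_sum]
  simp
  ring

theorem sum_fin_eq_sum_Icc (N : ℕ) (k : ℤ) (f : ℤ → ℝ) :
    ∑ j : Fin N, f ((j : ℕ) + k) = ∑ l ∈ Finset.Icc k ((N : ℤ) + k - 1), f l := by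
  refine Finset.sum_bij (fun j _ => ((j : ℕ) : ℤ) + k) ?_ ?_ ?_ ?_
  · intro j _
    have := j.2
    rw [Finset.mem_Icc]; omega
  · intro a _ b _ h
    exact Fin.ext (by omega)
  · intro b hb
    rw [Finset.mem_Icc] at hb
    exact ⟨⟨(b - k).toNat, by omega⟩, Finset.mem_univ _, by simp; omega⟩
  · intros; rfl

theorem formFactor_identity (N : ℕ) (t : ℝ) (k : ℕ) :
    ∑ j, ∑ l, charAverage N t (trivialWeight N + Pi.single j (k : ℤ) + Pi.single l (-(k : ℤ)))
      - (∑ j, charAverage N t (trivialWeight N + Pi.single j (k : ℤ)))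
        * (∑ l, charAverage N t (trivialWeight N + Pi.single l (-(k : ℤ)))) =
    formFactorSum N t k := by
  rcases Nat.eq_zero_or_pos k with rfl | hk
  · have h0 : Finset.Icc (0 : ℤ) (min (((0 : ℕ) : ℤ) - 1) N) = ∅ :=
      Finset.Icc_eq_empty (by simp)
    rw [formFactorSum, h0]
    simp [charAverage_trivialWeight]
  have hA : ∀ j : ℤ, ¬(0 ≤ j ∧ j ≤ (N : ℤ) - 1) → coeffA N t j = 0 := fun j hj =>
    not_not.1 fun h => hj ((coeffA_ne_zero_iff N t j).1 h)
  have hB : ∀ j : ℤ, (0 ≤ j ∧ j ≤ (N : ℤ) - 1) → coeffB N t j = 0 := fun j hj =>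
    not_not.1 fun h => (coeffB_ne_zero_iff N t j).1 h hj
  -- On the diagonal `G` is 0 by division by zero, which lets `h1` hold without restriction on `j`
  -- and `l`.
  set G : ℤ → ℤ → ℝ := fun j l => coeffA N t j * coeffB N t (j - k) * coeffA N t (l - k) *
    coeffB N t l / ((j : ℝ) - l) ^ 2 with hG
  have h1 : ∀ j l : Fin N, transferCoeff N t l ((j : ℕ) + k) *
      transferCoeff N t j ((l : ℕ) + -(k : ℤ)) =
      (if (l : ℕ) = j + k then 1 else 0) - G ((l : ℕ) + 0) ((j : ℕ) + k) := by
    intro j l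
    rw [add_zero]
    by_cases hl : (l : ℕ) = j + k
    · have e1 : ((j : ℕ) : ℤ) + k = (l : ℕ) := by rw [hl]; simp
      have e2 : ((l : ℕ) : ℤ) + -(k : ℤ) = (j : ℕ) := by rw [hl]; simp
      rw [if_pos hl, e2, e1, transferCoeff_self, transferCoeff_self]
      simp [hG]
    · have e1 : ((j : ℕ) : ℤ) + k ≠ (l : ℕ) := by omega
      have e2 : ((l : ℕ) : ℤ) + -(k : ℤ) ≠ (j : ℕ) := by omega
      have e3 : (((l : ℕ) : ℝ) - ((j : ℕ) + k)) ≠ 0 := by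
        rw [sub_ne_zero]; exact_mod_cast hl
      have e4 : (((j : ℕ) : ℝ) + k - (l : ℕ)) ≠ 0 := by
        intro h; apply e3; linarith
      have e5 : (((l : ℕ) : ℝ) + -k - (j : ℕ)) ≠ 0 := by
        intro h; apply e3; linarith
      rw [if_neg hl, transferCoeff_eq N t l e1, transferCoeff_eq N t j e2]
      simp only [hG, add_sub_cancel_right, ← sub_eq_add_neg]
      push_cast
      have e6 : (((l : ℕ) : ℝ) - k - (j : ℕ)) ≠ 0 := by
        intro h; apply e3; linarith
      field_simp
      ring
  -- The truncated subtraction is intended: there are no pairs when `k ≥ N`, and `N - (N - k)`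
  -- becomes `min k N`.
  have hcount : ∑ j : Fin N, ∑ l : Fin N, (if (l : ℕ) = j + k then (1 : ℝ) else 0) =
      ((N - k : ℕ) : ℝ) := by
    have : ∀ j : Fin N, ∑ l : Fin N, (if (l : ℕ) = j + k then (1 : ℝ) else 0) =
        if (j : ℕ) + k < N then 1 else 0 := by
      intro j
      by_cases hj : (j : ℕ) + k < N
      · rw [if_pos hj, Finset.sum_eq_single ⟨(j : ℕ) + k, hj⟩]
        · simp
        · intro l _ hl
          rw [if_neg fun h => hl (Fin.ext h)]
        · simp
      · rw [if_neg hj]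
        exact Finset.sum_eq_zero fun l _ => if_neg (by have := l.2; omega)
    simp only [this]
    rw [Fin.sum_univ_eq_sum_range (fun j => if j + k < N then (1 : ℝ) else 0),
      ← Finset.sum_filter, Finset.sum_const, nsmul_one]
    congr 1
    rw [← Finset.card_range (N - k)]
    congr 1
    ext i
    simp only [Finset.mem_filter, Finset.mem_range]
    omega
  rw [charAverage_sum_eq]
  simp only [h1, Finset.sum_sub_distrib]
  rw [hcount, Finset.sum_comm, formFactorSum]
  have h2 : ∀ l : Fin N, ∑ j : Fin N, G ((l : ℕ) + 0) ((j : ℕ) + k) =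
      ∑ m ∈ Finset.Icc (k : ℤ) ((N : ℤ) + k - 1), G ((l : ℕ) + 0) m := fun l =>
    sum_fin_eq_sum_Icc N k (fun m => G ((l : ℕ) + 0) m)
  simp only [h2]
  rw [sum_fin_eq_sum_Icc N 0 (fun x => ∑ m ∈ Finset.Icc (k : ℤ) ((N : ℤ) + k - 1), G x m)]
  -- Lowering the bound from `max k N` to `k` adds only indices `m < N`, where `b_m = 0`.
  have h3 : ∀ x : ℤ, ∑ m ∈ Finset.Icc (max (k : ℤ) N) ((N : ℤ) + k - 1), G x m =
      ∑ m ∈ Finset.Icc (k : ℤ) ((N : ℤ) + k - 1), G x m := by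
    intro x
    refine Finset.sum_subset (Finset.Icc_subset_Icc_left (le_max_left _ _)) fun m hm hm' => ?_
    rw [Finset.mem_Icc] at hm hm'
    simp [hG, hB m (by omega)]
  -- For `k ≤ x ≤ N` the factor `b_{x-k}` vanishes; `k ≥ 1` is needed at `x = N`. The index `x = N`
  -- may then be dropped because `a_N = 0`.
  have h4 : ∑ x ∈ Finset.Icc (0 : ℤ) (min ((k : ℤ) - 1) N),
      ∑ m ∈ Finset.Icc (max (k : ℤ) N) ((N : ℤ) + k - 1), G x m =
      ∑ x ∈ Finset.Icc (0 : ℤ) ((N : ℤ) + 0 - 1),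
        ∑ m ∈ Finset.Icc (k : ℤ) ((N : ℤ) + k - 1), G x m := by
    simp only [h3]
    trans ∑ x ∈ Finset.Icc (0 : ℤ) N, ∑ m ∈ Finset.Icc (k : ℤ) ((N : ℤ) + k - 1), G x m
    · refine Finset.sum_subset (Finset.Icc_subset_Icc_right (min_le_right _ _)) fun x hx hx' => ?_
      rw [Finset.mem_Icc] at hx hx'
      simp [hG, hB (x - k) (by omega)]
    · symm
      refine Finset.sum_subset (Finset.Icc_subset_Icc_right (by omega)) fun x hx hx' => ?_
      rw [Finset.mem_Icc] at hx hx'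
      simp [hG, hA x (by omega)]
  rw [h4]
  have h5 : (N : ℝ) - ((N - k : ℕ) : ℝ) = ((min k N : ℕ) : ℝ) := by
    rw [sub_eq_iff_eq_add]
    exact_mod_cast (by omega : N = min k N + (N - k))
  rw [← h5]; ring

/-! ### Alternants and power sums. -/

/-- The alternant `det (e^{i (n_j - (N-1)/2) x_l})`. -/
noncomputable def alternant (N : ℕ) (n : Fin N → ℤ) (x : Fin N → ℝ) : ℂ :=
  (Matrix.of fun l j : Fin N =>
    Complex.exp (Complex.I * (((n j : ℂ) - ((N : ℂ) - 1) / 2) * x l))).det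

theorem alternant_eq_sum (N : ℕ) (n : Fin N → ℤ) (x : Fin N → ℝ) :
    alternant N n x = ∑ σ : Equiv.Perm (Fin N), ((Equiv.Perm.sign σ : ℤ) : ℂ) *
      Complex.exp (Complex.I * ∑ j, (((n j : ℂ) - ((N : ℂ) - 1) / 2) * x (σ j))) := by
  rw [alternant, Matrix.det_apply']
  refine Finset.sum_congr rfl fun σ _ => ?_
  simp only [Matrix.of_apply]
  rw [← Complex.exp_sum, Finset.mul_sum]

/-- In the term of `σ`, the factor `e^{ikx_l}` raises the exponent at `j = σ⁻¹ l` by `k`; summing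
over `l` is summing over `j`. Shifted weights may repeat or be out of order, and no straightening is
needed. -/
theorem powerSum_mul_alternant (N : ℕ) (n : Fin N → ℤ) (k : ℤ) (x : Fin N → ℝ) :
    (∑ l, Complex.exp (Complex.I * k * x l)) * alternant N n x =
      ∑ j, alternant N (n + Pi.single j k) x := by
  simp only [alternant_eq_sum]
  rw [Finset.sum_comm, Finset.mul_sum]
  refine Finset.sum_congr rfl fun σ _ => ?_
  rw [← Finset.mul_sum, mul_left_comm, ← Equiv.sum_comp σ, Finset.sum_mul]
  congr 1
  refine Finset.sum_congr rfl fun j _ => ?_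
  rw [← Complex.exp_add]
  congr 1
  have : ∀ i, (((n + Pi.single j k : Fin N → ℤ) i : ℤ) : ℂ) = n i + if i = j then (k : ℂ) else 0 := by
    intro i
    by_cases h : i = j
    · subst h; simp
    · simp [h]
  simp only [this]
  have h2 : ∀ i, ((n i : ℂ) + (if i = j then (k : ℂ) else 0) - ((N : ℂ) - 1) / 2) * x (σ i) =
      ((n i : ℂ) - ((N : ℂ) - 1) / 2) * x (σ i) + if i = j then (k : ℂ) * x (σ i) else 0 := by
    intro i; split_ifs <;> ring
  simp only [h2, Finset.sum_add_distrib, Finset.sum_ite_eq', Finset.mem_univ, if_true]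
  ring

/-- `∏_{j<k} sin((x_k-x_j)/2)` -/
noncomputable def sinProd (N : ℕ) (x : Fin N → ℝ) : ℝ :=
  ∏ j, ∏ k ∈ Finset.Ioi j, Real.sin ((x k - x j) / 2)

/-- Each variable lies in `N - 1` pairs. The half-sum phases of the differences `e^{ix_k} -
e^{ix_j}` thus cancel the shift by `(N-1)/2` in the alternant. -/
theorem sum_Ioi_add (N : ℕ) (x : Fin N → ℂ) :
    ∑ j, ∑ k ∈ Finset.Ioi j, (x k + x j) = ((N : ℂ) - 1) * ∑ j, x j := by
  simp only [Finset.sum_add_distrib]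
  rw [Finset.sum_comm' (t' := Finset.univ) (s' := fun k => Finset.Iio k) (by simp),
    ← Finset.sum_add_distrib, Finset.mul_sum]
  refine Finset.sum_congr rfl fun j _ => ?_
  rw [Finset.sum_const, Finset.sum_const, Fin.card_Ioi, Fin.card_Iio, ← add_nsmul, nsmul_eq_mul]
  have := j.2
  congr 1
  rw [eq_sub_iff_add_eq]
  exact_mod_cast (by omega : (j : ℕ) + (N - 1 - j) + 1 = N)

theorem exp_sub_exp_eq_sin (a b : ℂ) : Complex.exp (Complex.I * b) - Complex.exp (Complex.I * a) =
    2 * Complex.I * (Complex.sin ((b - a) / 2) * Complex.exp (Complex.I * ((b + a) / 2))) := by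
  have h1 : Complex.I * b = (b - a) / 2 * Complex.I + Complex.I * ((b + a) / 2) := by ring
  have h2 : Complex.I * a = -((b - a) / 2) * Complex.I + Complex.I * ((b + a) / 2) := by ring
  rw [Complex.sin, h1, h2, Complex.exp_add, Complex.exp_add]
  linear_combination (Complex.exp ((b - a) / 2 * Complex.I) -
    Complex.exp (-((b - a) / 2) * Complex.I)) * Complex.exp (Complex.I * ((b + a) / 2)) *
    Complex.I_mul_I

theorem alternant_trivialWeight_eq_vandermonde (N : ℕ) (x : Fin N → ℝ) :
    alternant N (trivialWeight N) x = Complex.exp (-(Complex.I * (((N : ℂ) - 1) / 2 * ∑ l, (x l : ℂ))))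
      * ∏ j, ∏ k ∈ Finset.Ioi j,
        (Complex.exp (Complex.I * x k) - Complex.exp (Complex.I * x j)) := by
  rw [← Matrix.det_vandermonde fun l => Complex.exp (Complex.I * x l), Finset.mul_sum,
    Finset.mul_sum, ← Finset.sum_neg_distrib, Complex.exp_sum, ← Matrix.det_mul_column, alternant]
  congr 1
  ext l j
  simp only [Matrix.of_apply, Matrix.vandermonde_apply, trivialWeight, ← Complex.exp_nat_mul,
    ← Complex.exp_add]
  congr 1
  push_cast
  ring

theorem alternant_trivialWeight (N : ℕ) (x : Fin N → ℝ) :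
    alternant N (trivialWeight N) x =
      (∏ j : Fin N, ∏ _k ∈ Finset.Ioi j, (2 * Complex.I)) * sinProd N x := by
  rw [alternant_trivialWeight_eq_vandermonde]
  simp only [exp_sub_exp_eq_sin, Finset.prod_mul_distrib, ← Complex.exp_sum, ← Finset.mul_sum,
    ← Finset.sum_div]
  rw [sum_Ioi_add, sinProd]
  push_cast
  have : ∀ a b : ℂ, Complex.exp (-(Complex.I * (((N : ℂ) - 1) / 2 * ∑ l, (x l : ℂ)))) *
      (a * (b * Complex.exp (Complex.I * (((N : ℂ) - 1) * (∑ l, (x l : ℂ)) / 2)))) = a * b := by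
    intro a b
    have h : Complex.exp (-(Complex.I * (((N : ℂ) - 1) / 2 * ∑ l, (x l : ℂ)))) *
      Complex.exp (Complex.I * (((N : ℂ) - 1) * (∑ l, (x l : ℂ)) / 2)) = 1 := by
      rw [← Complex.exp_add, ← Complex.exp_zero]; congr 1; ring
    linear_combination (a * b) * h
  simpa [Finset.prod_mul_distrib] using this _ _

theorem powerSum_mul_powerSum_mul_alternant (N : ℕ) (k : ℤ) (x : Fin N → ℝ) :
    (∑ l, ∑ l', Complex.exp (Complex.I * k * (x l - x l'))) * alternant N (trivialWeight N) x =
      ∑ j, ∑ l, alternant N (trivialWeight N + Pi.single j k + Pi.single l (-k)) x := by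
  simp only [← powerSum_mul_alternant]
  rw [← Finset.mul_sum, ← powerSum_mul_alternant, ← mul_assoc, Finset.sum_mul_sum,
    Finset.sum_comm]
  congr 1
  refine Finset.sum_congr rfl fun l _ => Finset.sum_congr rfl fun l' _ => ?_
  rw [← Complex.exp_add]
  congr 1
  push_cast; ring

/-- A functional that maps an observable to the sum of the averages of the characters into which
the observable decomposes has the stated form factor. -/
theorem spectralFormFactor_eq (N : ℕ) (t : ℝ) (k : ℕ) (E : ((Fin N → ℝ) → ℂ) → ℂ)
    (S : Set ((Fin N → ℝ) → ℂ))
    (h2 : (fun x : Fin N → ℝ => ∑ l, ∑ l', Complex.exp (Complex.I * ((k : ℤ) : ℂ) * (x l - x l'))) ∈ S)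
    (h1 : ∀ m : ℤ, (fun x : Fin N → ℝ => ∑ l, Complex.exp (Complex.I * m * x l)) ∈ S)
    (hE : ∀ f ∈ S, ∀ (ι : Type) (s : Finset ι) (w : ι → Fin N → ℤ),
      (∀ x, f x * alternant N (trivialWeight N) x = ∑ i ∈ s, alternant N (w i) x) →
        E f = ((∑ i ∈ s, charAverage N t (w i) : ℝ) : ℂ)) :
    spectralFormFactor E k = (formFactorSum N t k : ℂ) := by
  have e1 := fun m : ℤ => hE _ (h1 m) (Fin N) Finset.univ
    (fun j => trivialWeight N + Pi.single j m) (by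
      intro x
      have := powerSum_mul_alternant N (trivialWeight N) m x
      exact this)
  have e3 := hE _ h2 (Fin N × Fin N) Finset.univ
    (fun p => trivialWeight N + Pi.single p.1 (k : ℤ) + Pi.single p.2 (-(k : ℤ))) (by
      intro x
      rw [powerSum_mul_powerSum_mul_alternant N k x, Fintype.sum_prod_type])
  rw [Fintype.sum_prod_type] at e3
  have e4 : (fun x : Fin N → ℝ => ∑ l, Complex.exp (-(Complex.I * ((k : ℤ) : ℂ) * x l))) =
      fun x : Fin N → ℝ => ∑ l, Complex.exp (Complex.I * ((-k : ℤ) : ℂ) * x l) := by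
    funext x
    refine Finset.sum_congr rfl fun l _ => ?_
    congr 1; push_cast; ring
  rw [spectralFormFactor, e4, e1, e1, e3, ← formFactor_identity]
  push_cast
  rfl

/-! ### Averages over the explicit density. -/

/-- Andréief's identity. -/
theorem integral_det_mul_det {ι α : Type*} [Fintype ι] [DecidableEq ι] [MeasurableSpace α]
    (ν : Measure α) [SigmaFinite ν] (φ ψ : ι → α → ℂ)
    (h : ∀ i k, Integrable (fun y => φ i y * ψ k y) ν) :
    Integrable (fun x : ι → α => (Matrix.of fun l j => φ j (x l)).det *
      (Matrix.of fun l k => ψ k (x l)).det) (Measure.pi fun _ => ν) ∧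
    ∫ x : ι → α, (Matrix.of fun l j => φ j (x l)).det * (Matrix.of fun l k => ψ k (x l)).det
      ∂(Measure.pi fun _ => ν) =
      (Fintype.card ι).factorial * (Matrix.of fun i k => ∫ y, φ i y * ψ k y ∂ν).det := by
  have hprod : ∀ (σ τ : Equiv.Perm ι) (x : ι → α),
      (∏ j, φ j (x (σ j))) * ∏ k, ψ k (x (τ k)) =
        ∏ y, (fun y' a => φ (σ.symm y') a * ψ (τ.symm y') a) y (x y) := by
    intro σ τ x
    rw [Finset.prod_mul_distrib, ← Equiv.prod_comp σ fun y => φ (σ.symm y) (x y),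
      ← Equiv.prod_comp τ fun y => ψ (τ.symm y) (x y)]
    simp
  have hint : ∀ σ τ : Equiv.Perm ι, Integrable (fun x : ι → α =>
      ((Equiv.Perm.sign σ : ℤ) : ℂ) * ((Equiv.Perm.sign τ : ℤ) : ℂ) *
        ∏ y, (fun y' a => φ (σ.symm y') a * ψ (τ.symm y') a) y (x y)) (Measure.pi fun _ => ν) :=
    fun σ τ => (Integrable.fintype_prod fun i => h _ _).const_mul _
  have hexp : ∀ x : ι → α, (Matrix.of fun l j => φ j (x l)).det *
      (Matrix.of fun l k => ψ k (x l)).det =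
      ∑ σ : Equiv.Perm ι, ∑ τ : Equiv.Perm ι,
        ((Equiv.Perm.sign σ : ℤ) : ℂ) * ((Equiv.Perm.sign τ : ℤ) : ℂ) *
          ∏ y, (fun y' a => φ (σ.symm y') a * ψ (τ.symm y') a) y (x y) := by
    intro x
    rw [Matrix.det_apply', Matrix.det_apply', Finset.sum_mul_sum]
    refine Finset.sum_congr rfl fun σ _ => Finset.sum_congr rfl fun τ _ => ?_
    rw [← hprod]
    simp only [Matrix.of_apply]
    ring
  simp only [hexp]
  refine ⟨integrable_finsetSum _ fun σ _ => integrable_finsetSum _ fun τ _ => hint σ τ, ?_⟩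
  rw [integral_finsetSum _ fun σ _ => integrable_finsetSum _ fun τ _ => hint σ τ]
  simp only [integral_finsetSum _ fun τ _ => hint _ τ]
  -- The substitution `τ ↦ σ τ` shows that every `σ` contributes the same determinant, whence the
  -- factorial.
  have hone : ∀ σ : Equiv.Perm ι, ∑ τ : Equiv.Perm ι, ∫ x : ι → α,
      ((Equiv.Perm.sign σ : ℤ) : ℂ) * ((Equiv.Perm.sign τ : ℤ) : ℂ) *
        ∏ y, (fun y' a => φ (σ.symm y') a * ψ (τ.symm y') a) y (x y) ∂(Measure.pi fun _ => ν) =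
      (Matrix.of fun i k => ∫ y, φ i y * ψ k y ∂ν).det := by
    intro σ
    rw [Matrix.det_apply', ← Equiv.sum_comp (Equiv.mulLeft σ)]
    refine Finset.sum_congr rfl fun τ _ => ?_
    rw [integral_const_mul, integral_fintype_prod_eq_prod (μ := fun _ => ν)
      (fun y a => φ (σ.symm y) a * ψ ((Equiv.mulLeft σ τ).symm y) a)]
    congr 1
    · simp only [Equiv.coe_mulLeft, Equiv.Perm.sign_mul, Units.val_mul, Int.cast_mul]
      rw [← mul_assoc, ← Int.cast_mul, ← Units.val_mul, Int.units_mul_self]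
      simp
    · rw [← Equiv.prod_comp (σ * τ)]
      refine Finset.prod_congr rfl fun k _ => ?_
      simp only [Equiv.coe_mulLeft, Equiv.symm_apply_apply, Matrix.of_apply, Equiv.Perm.mul_apply]
      have : (σ * τ).symm (σ (τ k)) = k := by
        rw [Equiv.symm_apply_eq]; rfl
      rw [this]
  simp only [hone]
  simp [Fintype.card_perm]

/-- The shift of the frequencies of the theta function. -/
noncomputable def thetaShift (N : ℕ) : ℝ := if Even N then 1 / 2 else 0

theorem thetaHalf_eq_tsum (N : ℕ) (q x : ℝ) :
    thetaHalf N q x = ∑' n : ℤ, ((q ^ (((n : ℝ) - thetaShift N) ^ 2) : ℝ) : ℂ) *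
      Complex.exp (Complex.I * (((n : ℝ) - thetaShift N : ℝ) : ℂ) * x) := by
  unfold thetaHalf thetaShift
  split_ifs
  · refine tsum_congr fun n => ?_
    congr 2; push_cast; ring
  · refine tsum_congr fun n => ?_
    rw [sub_zero]
    congr 2; push_cast; ring

/-- Comparison with the Jacobi theta bound through `(n-δ)² ≥ n² - 2|δ||n|`. It justifies
differentiating and integrating the theta series term by term. -/
theorem summable_pow_mul_gaussian (δ : ℝ) {q : ℝ} (hq0 : 0 < q) (hq1 : q < 1) (k : ℕ) :
    Summable fun n : ℤ => |(n : ℝ) - δ| ^ k * q ^ (((n : ℝ) - δ) ^ 2) := by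
  have ha : 0 < -Real.log q := by linarith [Real.log_neg hq0 hq1]
  set a := -Real.log q with hadef
  have hT : 0 < a / Real.pi := div_pos ha Real.pi_pos
  have hs : ∀ k : ℕ, Summable fun n : ℤ => (|n| : ℝ) ^ k *
      Real.exp (-Real.pi * (a / Real.pi * n ^ 2 - 2 * (a * |δ| / Real.pi) * |n|)) := by
    intro k
    have := summable_pow_mul_jacobiTheta₂_term_bound (a * |δ| / Real.pi) hT k
    refine this.congr fun n => ?_
    push_cast
    rfl
  have hsum := ((hs k).add ((hs 0).mul_left (|δ| ^ k))).mul_left (2 ^ (k - 1))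
  refine Summable.of_nonneg_of_le (fun n => by positivity) (fun n => ?_) hsum
  have h1 : |(n : ℝ) - δ| ^ k ≤ 2 ^ (k - 1) * (|(n : ℝ)| ^ k + |δ| ^ k) :=
    (pow_le_pow_left₀ (abs_nonneg _) (abs_sub _ _) k).trans
      (add_pow_le (abs_nonneg _) (abs_nonneg _) k)
  have h2 : q ^ (((n : ℝ) - δ) ^ 2) ≤
      Real.exp (-Real.pi * (a / Real.pi * n ^ 2 - 2 * (a * |δ| / Real.pi) * |(n : ℝ)|)) := by
    rw [Real.rpow_def_of_pos hq0, Real.exp_le_exp]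
    have hlog : Real.log q = -a := by rw [hadef]; ring
    have e : -Real.pi * (a / Real.pi * n ^ 2 - 2 * (a * |δ| / Real.pi) * |(n : ℝ)|) =
        -a * (n ^ 2 - 2 * (|δ| * |(n : ℝ)|)) := by
      field_simp
    rw [e, hlog]
    have h3 : δ * n ≤ |δ| * |(n : ℝ)| := by rw [← abs_mul]; exact le_abs_self _
    nlinarith [sq_nonneg δ]
  calc |(n : ℝ) - δ| ^ k * q ^ (((n : ℝ) - δ) ^ 2)
      ≤ (2 ^ (k - 1) * (|(n : ℝ)| ^ k + |δ| ^ k)) *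
        Real.exp (-Real.pi * (a / Real.pi * n ^ 2 - 2 * (a * |δ| / Real.pi) * |(n : ℝ)|)) := by
        gcongr
    _ = _ := by rw [pow_zero, Int.cast_abs]; ring

theorem norm_exp_I_mul_ofReal_mul_ofReal (s x : ℝ) :
    ‖Complex.exp (Complex.I * (s : ℂ) * x)‖ = 1 := by
  rw [Complex.norm_exp]
  simp

/-- The `n`-th term of the `k`-th derivative of the theta series. -/
noncomputable def thetaTerm (δ q : ℝ) (k : ℕ) (n : ℤ) (x : ℝ) : ℂ :=
  (Complex.I * (((n : ℝ) - δ : ℝ) : ℂ)) ^ k * ((q ^ (((n : ℝ) - δ) ^ 2) : ℝ) : ℂ) *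
      Complex.exp (Complex.I * (((n : ℝ) - δ : ℝ) : ℂ) * x)

theorem norm_thetaTerm (δ : ℝ) {q : ℝ} (hq : 0 < q) (k : ℕ) (n : ℤ) (x : ℝ) :
    ‖thetaTerm δ q k n x‖ = |(n : ℝ) - δ| ^ k * q ^ (((n : ℝ) - δ) ^ 2) := by
  rw [thetaTerm, norm_mul, norm_exp_I_mul_ofReal_mul_ofReal, mul_one, norm_mul, norm_pow, norm_mul,
    Complex.norm_I, one_mul, Complex.norm_real, Complex.norm_real, Real.norm_eq_abs,
    Real.norm_of_nonneg (Real.rpow_nonneg hq.le _)]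

theorem hasDerivAt_thetaTerm (δ q : ℝ) (k : ℕ) (n : ℤ) (x : ℝ) :
    HasDerivAt (thetaTerm δ q k n) (thetaTerm δ q (k + 1) n x) x := by
  have h := ((Complex.ofRealCLM.hasDerivAt (x := x)).const_mul
    (Complex.I * (((n : ℝ) - δ : ℝ) : ℂ))).cexp.const_mul
    ((Complex.I * (((n : ℝ) - δ : ℝ) : ℂ)) ^ k * ((q ^ (((n : ℝ) - δ) ^ 2) : ℝ) : ℂ))
  refine h.congr_deriv ?_
  simp only [thetaTerm, Complex.ofRealCLM_apply]
  push_cast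
  ring

theorem iteratedDeriv_thetaHalf (N : ℕ) {q : ℝ} (hq0 : 0 < q) (hq1 : q < 1) (k : ℕ) :
    iteratedDeriv k (thetaHalf N q) = fun x => ∑' n : ℤ, thetaTerm (thetaShift N) q k n x := by
  induction k with
  | zero =>
    funext x
    rw [iteratedDeriv_zero, thetaHalf_eq_tsum]
    exact tsum_congr fun n => by simp [thetaTerm]
  | succ k ih =>
    rw [iteratedDeriv_succ, ih]
    funext x
    refine (hasDerivAt_tsum (summable_pow_mul_gaussian (thetaShift N) hq0 hq1 (k + 1))
      (fun n y => hasDerivAt_thetaTerm _ _ _ _ _) (fun n y => (norm_thetaTerm _ hq0 _ _ _).le)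
      (y₀ := 0) ?_ x).deriv
    refine Summable.of_norm ?_
    simpa only [norm_thetaTerm _ hq0] using summable_pow_mul_gaussian (thetaShift N) hq0 hq1 k

theorem continuous_iteratedDeriv_thetaHalf (N : ℕ) {q : ℝ} (hq0 : 0 < q) (hq1 : q < 1) (k : ℕ) :
    Continuous (iteratedDeriv k (thetaHalf N q)) := by
  rw [iteratedDeriv_thetaHalf N hq0 hq1]
  exact continuous_tsum (fun n => continuous_iff_continuousAt.2 fun x =>
    (hasDerivAt_thetaTerm _ _ _ _ _).continuousAt)
    (summable_pow_mul_gaussian (thetaShift N) hq0 hq1 k) (fun n x => (norm_thetaTerm _ hq0 _ _ _).le)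

theorem integral_exp_int_mul (m : ℤ) :
    ∫ x in Set.Icc (-Real.pi) Real.pi, Complex.exp (Complex.I * m * (x : ℂ)) =
      if m = 0 then 2 * (Real.pi : ℂ) else 0 := by
  rw [integral_Icc_eq_integral_Ioc, ← intervalIntegral.integral_of_le (by linarith [Real.pi_pos])]
  split_ifs with h
  · subst h; simp; ring
  · have hm : Complex.I * (m : ℂ) ≠ 0 := mul_ne_zero Complex.I_ne_zero (by exact_mod_cast h)
    rw [integral_exp_mul_complex hm, div_eq_zero_iff]
    left
    rw [sub_eq_zero, Complex.exp_eq_exp_iff_exists_int]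
    exact ⟨m, by push_cast; ring⟩

/-- The Fourier coefficients of the derivatives of the theta function. -/
theorem integral_exp_mul_iteratedDeriv_thetaHalf (N : ℕ) {q : ℝ} (hq0 : 0 < q) (hq1 : q < 1)
    (k : ℕ) (m : ℤ) :
    ∫ x in Set.Icc (-Real.pi) Real.pi,
      Complex.exp (Complex.I * (((m : ℂ) - ((N : ℂ) - 1) / 2) * x)) *
        iteratedDeriv k (thetaHalf N q) x =
      2 * Real.pi * (-(Complex.I * ((m : ℂ) - ((N : ℂ) - 1) / 2))) ^ k *
        ((q ^ (((m : ℝ) - ((N : ℝ) - 1) / 2) ^ 2) : ℝ) : ℂ) := by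
  -- The exponents `m - (N-1)/2` are half-integers for even `N` and integers for odd `N`. The choice
  -- of `κ` puts the theta frequencies on the same lattice, so exactly one frequency, indexed by
  -- `p`, survives orthogonality.
  obtain ⟨p, hp⟩ : ∃ p : ℤ, (m : ℝ) - ((N : ℝ) - 1) / 2 = -((p : ℝ) - thetaShift N) := by
    unfold thetaShift
    rcases Nat.even_or_odd' N with ⟨r, hr | hr⟩
    · refine ⟨r - m, ?_⟩
      rw [if_pos (by rw [hr]; exact even_two_mul r), hr]
      push_cast; ring
    · refine ⟨r - m, ?_⟩
      rw [if_neg (by rw [hr]; exact Nat.not_even_two_mul_add_one r), hr]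
      push_cast; ring
  have hpc : (m : ℂ) - ((N : ℂ) - 1) / 2 = -(((p : ℝ) - thetaShift N : ℝ) : ℂ) := by
    rw [← Complex.ofReal_neg, ← hp]; push_cast; ring
  have hterm : ∀ (n : ℤ) (x : ℝ), Complex.exp (Complex.I * (((m : ℂ) - ((N : ℂ) - 1) / 2) * x)) *
      thetaTerm (thetaShift N) q k n x =
      ((Complex.I * (((n : ℝ) - thetaShift N : ℝ) : ℂ)) ^ k *
        ((q ^ (((n : ℝ) - thetaShift N) ^ 2) : ℝ) : ℂ)) *
        Complex.exp (Complex.I * ((n - p : ℤ) : ℂ) * x) := by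
    intro n x
    rw [thetaTerm, mul_left_comm, ← Complex.exp_add, hpc]
    congr 2
    push_cast; ring
  have hnorm : ∀ (n : ℤ) (x : ℝ), ‖((Complex.I * (((n : ℝ) - thetaShift N : ℝ) : ℂ)) ^ k *
        ((q ^ (((n : ℝ) - thetaShift N) ^ 2) : ℝ) : ℂ)) *
        Complex.exp (Complex.I * ((n - p : ℤ) : ℂ) * x)‖ =
        |(n : ℝ) - thetaShift N| ^ k * q ^ (((n : ℝ) - thetaShift N) ^ 2) := by
    intro n x
    rw [← norm_thetaTerm _ hq0 k n x, thetaTerm, norm_mul, norm_mul (_ * _),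
      norm_exp_I_mul_ofReal_mul_ofReal]
    congr 1
    exact_mod_cast norm_exp_I_mul_ofReal_mul_ofReal ((n - p : ℤ) : ℝ) x
  rw [iteratedDeriv_thetaHalf N hq0 hq1]
  simp only [← tsum_mul_left, hterm]
  rw [← integral_tsum_of_summable_integral_norm]
  · simp only [integral_const_mul, integral_exp_int_mul]
    rw [tsum_eq_single p]
    · rw [hp, hpc]
      simp only [sub_self, if_true, neg_sq]
      push_cast
      ring
    · intro n hn
      rw [if_neg (sub_ne_zero.2 hn), mul_zero]
  · intro n
    refine Continuous.integrableOn_Icc ?_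
    fun_prop
  · simp only [hnorm]
    simpa using (summable_pow_mul_gaussian (thetaShift N) hq0 hq1 k).mul_left
      (max (Real.pi + Real.pi) 0)

theorem sum_sq_trivialWeight (N : ℕ) :
    ∑ j : Fin N, (((j : ℕ) : ℝ) - ((N : ℝ) - 1) / 2) ^ 2 = (N : ℝ) * ((N : ℝ) ^ 2 - 1) / 12 := by
  have h : ∀ (a : ℝ) (n : ℕ), ∑ j ∈ Finset.range n, ((j : ℝ) - a) ^ 2 =
      n * (n - 1) * (2 * n - 1) / 6 - a * (n * (n - 1)) + n * a ^ 2 := by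
    intro a n
    induction n with
    | zero => simp
    | succ n ih => rw [Finset.sum_range_succ, ih]; push_cast; ring
  rw [Fin.sum_univ_eq_sum_range (fun j => ((j : ℝ) - ((N : ℝ) - 1) / 2) ^ 2), h]
  ring

/-- Splits the normalisation of the density: `N!` cancels the factor from Andréief's identity, and
the Vandermonde determinant is the denominator of `vandermondeRatio`. -/
theorem prod_factorial_Icc {N : ℕ} (hN : 1 ≤ N) :
    ∏ l ∈ Finset.Icc 1 N, (l.factorial : ℝ) =
      N.factorial * (Matrix.vandermonde fun i : Fin N => ((i : ℕ) : ℝ)).det := by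
  obtain ⟨n, rfl⟩ := Nat.exists_eq_add_of_le' hN
  rw [Matrix.det_vandermonde_id_eq_superFactorial, ← Nat.cast_prod, Nat.prod_Icc_factorial,
    Nat.superFactorial_succ, Nat.cast_mul]

theorem two_I_constant_ne_zero (N : ℕ) :
    (∏ j : Fin N, ∏ _k ∈ Finset.Ioi j, (2 * Complex.I)) ≠ 0 :=
  Finset.prod_ne_zero_iff.2 fun _ _ => Finset.prod_ne_zero_iff.2 fun _ _ =>
    mul_ne_zero two_ne_zero Complex.I_ne_zero

theorem det_vandermonde_two_I_mul (N : ℕ) (n : Fin N → ℤ) :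
    (Matrix.vandermonde fun j => 2 * Complex.I * ((n j : ℂ) - ((N : ℂ) - 1) / 2)).det =
      (∏ j : Fin N, ∏ _k ∈ Finset.Ioi j, (2 * Complex.I)) *
        (((Matrix.vandermonde fun i => (n i : ℝ)).det : ℝ) : ℂ) := by
  rw [Matrix.det_vandermonde, Matrix.det_vandermonde]
  push_cast
  simp only [← Finset.prod_mul_distrib]
  refine Finset.prod_congr rfl fun i _ => Finset.prod_congr rfl fun j _ => ?_
  ring

/-- The determinant in the explicit density. -/
noncomputable def thetaDet (N : ℕ) (q : ℝ) (x : Fin N → ℝ) : ℂ :=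
  (Matrix.of fun j k : Fin N =>
    (-2 : ℂ) ^ (k : ℕ) * iteratedDeriv (k : ℕ) (thetaHalf N q) (x j)).det

/-- The `k`-th derivative multiplies a Fourier coefficient by a `k`-th power of its frequency, so
the matrix in Andréief's identity is a Vandermonde matrix with rows scaled by Gaussian weights. -/
theorem integral_alternant_mul_thetaDet (N : ℕ) {q : ℝ} (hq0 : 0 < q) (hq1 : q < 1)
    (n : Fin N → ℤ) :
    IntegrableOn (fun x => alternant N n x * thetaDet N q x)
      (Set.Icc (fun _ : Fin N => -Real.pi) (fun _ => Real.pi)) ∧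
    ∫ x in Set.Icc (fun _ : Fin N => -Real.pi) (fun _ => Real.pi),
        alternant N n x * thetaDet N q x =
      (∏ j : Fin N, ∏ _k ∈ Finset.Ioi j, (2 * Complex.I)) *
      ((N.factorial * (2 * Real.pi) ^ N *
        q ^ (∑ j, ((n j : ℝ) - ((N : ℝ) - 1) / 2) ^ 2) *
        (Matrix.vandermonde fun i => (n i : ℝ)).det : ℝ) : ℂ) := by
  have hν : (volume : Measure (Fin N → ℝ)).restrict
      (Set.Icc (fun _ : Fin N => -Real.pi) (fun _ => Real.pi)) =
      Measure.pi fun _ : Fin N => (volume : Measure ℝ).restrict (Set.Icc (-Real.pi) Real.pi) := by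
    rw [← Set.pi_univ_Icc, volume_pi, Measure.restrict_pi_pi]
  have hφ : ∀ j k : Fin N, Integrable (fun y : ℝ =>
      (fun (j : Fin N) (y : ℝ) => Complex.exp (Complex.I * (((n j : ℂ) - ((N : ℂ) - 1) / 2) * y)))
        j y * (fun (k : Fin N) (y : ℝ) => (-2 : ℂ) ^ (k : ℕ) *
          iteratedDeriv (k : ℕ) (thetaHalf N q) y) k y)
      ((volume : Measure ℝ).restrict (Set.Icc (-Real.pi) Real.pi)) := by
    intro j k
    have := continuous_iteratedDeriv_thetaHalf N hq0 hq1 k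
    exact Continuous.integrableOn_Icc (by fun_prop)
  obtain ⟨h1, h2⟩ := integral_det_mul_det _ _ _ hφ
  refine ⟨?_, ?_⟩
  · rw [IntegrableOn, hν]; exact h1
  · rw [hν]
    refine h2.trans ?_
    have hM : (Matrix.of fun j k : Fin N => ∫ y in Set.Icc (-Real.pi) Real.pi,
        Complex.exp (Complex.I * (((n j : ℂ) - ((N : ℂ) - 1) / 2) * y)) *
          ((-2 : ℂ) ^ (k : ℕ) * iteratedDeriv (k : ℕ) (thetaHalf N q) y)) =
        Matrix.of fun j k : Fin N =>
          (2 * Real.pi * ((q ^ (((n j : ℝ) - ((N : ℝ) - 1) / 2) ^ 2) : ℝ) : ℂ)) *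
          Matrix.vandermonde (fun j => 2 * Complex.I * ((n j : ℂ) - ((N : ℂ) - 1) / 2)) j k := by
      ext j k
      simp only [Matrix.of_apply, mul_left_comm _ ((-2 : ℂ) ^ (k : ℕ)), integral_const_mul]
      rw [integral_exp_mul_iteratedDeriv_thetaHalf N hq0 hq1, Matrix.vandermonde_apply]
      have : 2 * Complex.I * ((n j : ℂ) - ((N : ℂ) - 1) / 2) =
        (-2) * (-(Complex.I * ((n j : ℂ) - ((N : ℂ) - 1) / 2))) := by ring
      rw [this, mul_pow]
      ring
    rw [hM, Matrix.det_mul_column, det_vandermonde_two_I_mul, Finset.prod_mul_distrib,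
      Finset.prod_const, Real.rpow_sum_of_pos hq0]
    simp only [Fintype.card_fin, Finset.card_univ]
    push_cast
    ring

theorem dysonAverage_eq_sum {N : ℕ} (hN : 1 ≤ N) {t : ℝ} (ht : 0 < t) (f : (Fin N → ℝ) → ℂ)
    {ι : Type*} (s : Finset ι) (w : ι → Fin N → ℤ)
    (h : ∀ x, f x * alternant N (trivialWeight N) x = ∑ i ∈ s, alternant N (w i) x) :
    dysonAverage N t f = ((∑ i ∈ s, charAverage N t (w i) : ℝ) : ℂ) := by
  have hq0 := dysonQ_pos N t
  have hNR : (0 : ℝ) < N := by exact_mod_cast hN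
  have hq1 : dysonQ N t < 1 := by
    rw [dysonQ, Real.exp_lt_one_iff, neg_div, neg_lt_zero]; positivity
  have hκ := two_I_constant_ne_zero N
  -- The density already contains the denominator alternant, so this holds at every point,
  -- coincident angles included.
  have hd : ∀ x, f x * dysonDensity N t x =
      (((dysonQ N t ^ (-((N : ℝ) * ((N : ℝ) ^ 2 - 1) / 12))
        / ((2 * Real.pi) ^ N * ∏ l ∈ Finset.Icc 1 N, (l.factorial : ℝ)) : ℝ) : ℂ) *
        (∏ j : Fin N, ∏ _k ∈ Finset.Ioi j, (2 * Complex.I))⁻¹) *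
        ∑ i ∈ s, alternant N (w i) x * thetaDet N (dysonQ N t) x := by
    intro x
    rw [← Finset.sum_mul, ← h, alternant_trivialWeight, dysonDensity]
    change f x * (_ * ((sinProd N x : ℝ) : ℂ) * thetaDet N (dysonQ N t) x) = _
    field_simp
  have hI := fun n => integral_alternant_mul_thetaDet N hq0 hq1 n
  rw [dysonAverage]
  simp only [hd]
  rw [integral_const_mul, integral_finsetSum _ fun i _ => (hI (w i)).1]
  simp only [(hI _).2]
  rw [← Finset.mul_sum, ← mul_assoc, mul_assoc _ _⁻¹, inv_mul_cancel₀ hκ, mul_one,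
    ← Complex.ofReal_sum, ← Complex.ofReal_mul]
  congr 1
  rw [Finset.mul_sum]
  refine Finset.sum_congr rfl fun i _ => ?_
  rw [charAverage, vandermondeRatio, prod_factorial_Icc hN, Finset.sum_sub_distrib,
    sum_sq_trivialWeight, Real.rpow_sub hq0, Real.rpow_neg hq0.le]
  have hv := vandermonde_nodes_ne_zero N
  have hf : (N.factorial : ℝ) ≠ 0 := by positivity
  have hp : (2 * Real.pi) ^ N ≠ 0 := by positivity
  have hr := (Real.rpow_pos_of_pos hq0 ((N : ℝ) * ((N : ℝ) ^ 2 - 1) / 12)).ne'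
  field_simp

theorem spectralFormFactor_dysonAverage {N : ℕ} (hN : 1 ≤ N) {t : ℝ} (ht : 0 < t) (k : ℕ) :
    spectralFormFactor (dysonAverage N t) k = (formFactorSum N t k : ℂ) :=
  spectralFormFactor_eq N t k _ Set.univ trivial (fun _ => trivial)
    fun f _ _ s w h => dysonAverage_eq_sum hN ht f s w h

/-! ### Characters as smooth functions of the angles. -/

/-- The Schur polynomial with shifted highest weight `m`, evaluated at `z`: the determinant of the
coefficients of the powers `X ^ m j` reduced modulo `∏ (X - z l)`. -/
noncomputable def schurDet {A : Type*} [CommRing A] {N : ℕ} (z : Fin N → A) (m : Fin N → ℕ) : A :=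
  (Matrix.of fun a j : Fin N =>
    ((Polynomial.X : Polynomial A) ^ m j %ₘ ∏ l, (Polynomial.X - Polynomial.C (z l))).coeff a).det

theorem monic_prod_X_sub_C {A ι : Type*} [CommRing A] [Fintype ι] (z : ι → A) :
    (∏ l, (Polynomial.X - Polynomial.C (z l))).Monic :=
  Polynomial.monic_prod_of_monic _ _ fun l _ => Polynomial.monic_X_sub_C (z l)

theorem map_schurDet {A B : Type*} [CommRing A] [CommRing B] {N : ℕ} (φ : A →+* B)
    (z : Fin N → A) (m : Fin N → ℕ) : φ (schurDet z m) = schurDet (fun l => φ (z l)) m := by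
  rw [schurDet, RingHom.map_det, schurDet]
  congr 1
  ext a j
  simp only [RingHom.mapMatrix_apply, Matrix.map_apply, Matrix.of_apply]
  rw [← Polynomial.coeff_map, Polynomial.map_modByMonic _ (monic_prod_X_sub_C z)]
  simp [Polynomial.map_prod]

theorem schurDet_comp_perm {A : Type*} [CommRing A] {N : ℕ} (z : Fin N → A) (m : Fin N → ℕ)
    (σ : Equiv.Perm (Fin N)) : schurDet (fun l => z (σ l)) m = schurDet z m := by
  rw [schurDet, schurDet, Equiv.prod_comp σ fun l => Polynomial.X - Polynomial.C (z l)]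

/-- At the root `z l` of the modulus, `X ^ m j` and its remainder agree, and the remainder has
degree below `N`. The quotient of alternants is thus obtained without division, even for coincident
`z`. -/
theorem det_pow_eq_vandermonde_mul_schurDet {A : Type*} [CommRing A] {N : ℕ} (z : Fin N → A)
    (m : Fin N → ℕ) :
    (Matrix.of fun l j => z l ^ m j).det = (Matrix.vandermonde z).det * schurDet z m := by
  nontriviality A
  rw [schurDet, ← Matrix.det_mul]
  congr 1
  ext l j
  set P := ∏ l, (Polynomial.X - Polynomial.C (z l)) with hP
  have hm : P.Monic := monic_prod_X_sub_C z
  have hroot : P.eval (z l) = 0 := by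
    rw [hP, Polynomial.eval_prod]
    exact Finset.prod_eq_zero (Finset.mem_univ l) (by simp)
  have hdeg : ((Polynomial.X : Polynomial A) ^ m j %ₘ P).degree < N := by
    refine (Polynomial.degree_modByMonic_lt _ hm).trans_eq ?_
    rw [hP, Polynomial.degree_prod_of_monic _ _ fun l _ => Polynomial.monic_X_sub_C (z l)]
    simp
  have h1 : ((Polynomial.X : Polynomial A) ^ m j %ₘ P).eval (z l) = z l ^ m j := by
    have := congrArg (Polynomial.eval (z l))
      (Polynomial.modByMonic_add_div ((Polynomial.X : Polynomial A) ^ m j) P)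
    simpa [hroot] using this
  rw [Matrix.of_apply, ← h1, Polynomial.eval_eq_sum_degreeLTEquiv (Polynomial.mem_degreeLT.2 hdeg),
    Matrix.mul_apply]
  simp [Polynomial.degreeLTEquiv, Matrix.vandermonde_apply, mul_comm]

/-- Weyl's dimension formula by principal specialisation: at `z l = X ^ l` both determinants are
Vandermonde in powers of `X`. Cancel one factor `X - 1` per pair and set `X = 1`. -/
theorem schurDet_one_mul {N : ℕ} (m : Fin N → ℕ) :
    schurDet (fun _ : Fin N => (1 : ℂ)) m * (Matrix.vandermonde fun i : Fin N => ((i : ℕ) : ℂ)).det =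
      (Matrix.vandermonde fun i => (m i : ℂ)).det := by
  have h := det_pow_eq_vandermonde_mul_schurDet
    (fun l : Fin N => (Polynomial.X : Polynomial ℂ) ^ (l : ℕ)) m
  have h1 : (Matrix.of fun l j : Fin N => ((Polynomial.X : Polynomial ℂ) ^ (l : ℕ)) ^ m j) =
      (Matrix.vandermonde fun j => (Polynomial.X : Polynomial ℂ) ^ m j).transpose := by
    ext1 l j
    simp only [Matrix.of_apply, Matrix.transpose_apply, Matrix.vandermonde_apply, ← pow_mul,
      mul_comm]
  rw [h1, Matrix.det_transpose, Matrix.det_vandermonde, Matrix.det_vandermonde] at h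
  have hg : ∀ a b : ℕ, (Polynomial.X : Polynomial ℂ) ^ a - Polynomial.X ^ b =
      (Polynomial.X - 1) * (∑ i ∈ Finset.range a, Polynomial.X ^ i -
        ∑ i ∈ Finset.range b, Polynomial.X ^ i) := by
    intro a b
    rw [mul_sub, mul_geom_sum, mul_geom_sum]; ring
  simp only [hg, Finset.prod_mul_distrib] at h
  have hne : (∏ i : Fin N, ∏ _j ∈ Finset.Ioi i, ((Polynomial.X : Polynomial ℂ) - 1)) ≠ 0 :=
    Finset.prod_ne_zero_iff.2 fun _ _ => Finset.prod_ne_zero_iff.2 fun _ _ =>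
      Polynomial.X_sub_C_ne_zero 1
  rw [mul_assoc] at h
  have h2 := congrArg (Polynomial.evalRingHom (1 : ℂ)) (mul_left_cancel₀ hne h)
  rw [map_mul, map_schurDet] at h2
  simp only [map_prod, map_sub, map_sum, map_pow, Polynomial.coe_evalRingHom, Polynomial.eval_X,
    one_pow, Finset.sum_const, Finset.card_range, nsmul_eq_mul, mul_one] at h2
  rw [Matrix.det_vandermonde, Matrix.det_vandermonde, h2, mul_comm]

theorem MvPolynomial.contDiff_eval {E ι : Type*} [Fintype ι] [NormedAddCommGroup E]
    [NormedSpace ℝ E] (p : MvPolynomial ι ℂ) {z : E → ι → ℂ} {n : WithTop ℕ∞}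
    (hz : ∀ l, ContDiff ℝ n fun x => z x l) : ContDiff ℝ n fun x => MvPolynomial.eval (z x) p := by
  simp only [MvPolynomial.eval_eq']
  exact ContDiff.sum fun d _ => contDiff_const.mul (contDiff_prod fun i _ => (hz i).pow _)

theorem contDiff_exp_I_mul {N : ℕ} (l : Fin N) :
    ContDiff ℝ ∞ fun x : Fin N → ℝ => Complex.exp (Complex.I * (x l : ℂ)) := by
  have : ContDiff ℝ ∞ fun x : Fin N → ℝ => (x l : ℂ) :=
    Complex.ofRealCLM.contDiff.comp (contDiff_apply ℝ ℝ l)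
  exact (contDiff_const.mul this).cexp

theorem exp_I_mul_update {N : ℕ} (x : Fin N → ℝ) (j l : Fin N) :
    Complex.exp (Complex.I * (Function.update x j (x j + 2 * Real.pi) l : ℝ)) =
      Complex.exp (Complex.I * (x l : ℝ)) := by
  by_cases h : l = j
  · subst h
    rw [Function.update_self, Complex.exp_eq_exp_iff_exists_int]
    exact ⟨1, by push_cast; ring⟩
  · rw [Function.update_of_ne h]

theorem MvPolynomial.norm_eval_le {ι : Type*} [Fintype ι] (p : MvPolynomial ι ℂ) {z : ι → ℂ}
    (hz : ∀ l, ‖z l‖ = 1) : ‖MvPolynomial.eval z p‖ ≤ ∑ d ∈ p.support, ‖p.coeff d‖ := by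
  rw [MvPolynomial.eval_eq']
  refine (norm_sum_le _ _).trans_eq (Finset.sum_congr rfl fun d _ => ?_)
  simp [hz]

/-- The characters of `U(N)` as functions of the eigenvalue angles. -/
theorem exists_character (N : ℕ) (n : Fin N → ℤ) : ∃ f : (Fin N → ℝ) → ℂ,
    IsAngleTestFunction N f ∧ (∀ x, f x * alternant N (trivialWeight N) x = alternant N n x) ∧
      f 0 = (vandermondeRatio N n : ℂ) ∧ ∃ C, ∀ x, ‖f x‖ ≤ C := by
  -- A common shift makes the weights natural numbers; it is undone by the factor `(∏
  -- e^{ix_l})^{-K}`.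
  obtain ⟨K, m, hm⟩ : ∃ (K : ℕ) (m : Fin N → ℕ), ∀ j, n j = m j - K := by
    refine ⟨∑ j, (n j).natAbs, fun j => (n j + (∑ j, (n j).natAbs : ℕ)).toNat, fun j => ?_⟩
    have : (n j).natAbs ≤ ∑ j, (n j).natAbs :=
      Finset.single_le_sum (f := fun j => (n j).natAbs) (fun _ _ => Nat.zero_le _)
        (Finset.mem_univ j)
    rw [Int.toNat_of_nonneg (by omega)]
    ring
  have hX : ∀ x : Fin N → ℝ, schurDet (fun l => Complex.exp (Complex.I * x l)) m =
      MvPolynomial.eval (fun l => Complex.exp (Complex.I * x l))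
        (schurDet (fun l : Fin N => (MvPolynomial.X l : MvPolynomial (Fin N) ℂ)) m) := by
    intro x
    rw [map_schurDet]
    simp
  refine ⟨fun x => (∏ l, Complex.exp (Complex.I * x l))⁻¹ ^ K *
    schurDet (fun l => Complex.exp (Complex.I * x l)) m, ⟨?_, ?_, ?_⟩, ?_, ?_, ?_⟩
  · simp only [hX]
    refine ContDiff.mul (ContDiff.pow (ContDiff.inv (contDiff_prod fun l _ => contDiff_exp_I_mul l)
      fun x => Finset.prod_ne_zero_iff.2 fun _ _ => Complex.exp_ne_zero _) _)
      (MvPolynomial.contDiff_eval _ contDiff_exp_I_mul)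
  · intro j x
    simp only [exp_I_mul_update]
  · intro σ x
    simp only [Function.comp_apply]
    rw [schurDet_comp_perm (fun l => Complex.exp (Complex.I * x l)),
      Equiv.prod_comp σ fun l => Complex.exp (Complex.I * x l)]
  · intro x
    have h := det_pow_eq_vandermonde_mul_schurDet (fun l => Complex.exp (Complex.I * x l)) m
    rw [alternant_trivialWeight_eq_vandermonde,
      ← Matrix.det_vandermonde fun l => Complex.exp (Complex.I * x l),
      mul_mul_mul_comm, mul_comm (schurDet _ _), ← h, ← Complex.exp_sum, ← Complex.exp_neg,
      ← Complex.exp_nat_mul, ← Complex.exp_add, ← Finset.mul_sum]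
    have e : (K : ℂ) * -(Complex.I * ∑ l, (x l : ℂ)) +
        -(Complex.I * (((N : ℂ) - 1) / 2 * ∑ l, (x l : ℂ))) =
        ∑ l, -(Complex.I * ((((N : ℂ) - 1) / 2 + K) * x l)) := by
      rw [Finset.sum_neg_distrib, ← Finset.mul_sum, ← Finset.mul_sum]; ring
    rw [e, Complex.exp_sum, ← Matrix.det_mul_column, alternant]
    congr 1
    ext l j
    simp only [Matrix.of_apply, ← Complex.exp_nat_mul, ← Complex.exp_add, hm]
    congr 1
    push_cast; ring
  · have h := schurDet_one_mul m
    have hv := vandermonde_nodes_ne_zero N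
    have hv1 : (Matrix.vandermonde fun i : Fin N => ((i : ℕ) : ℂ)).det =
        (((Matrix.vandermonde fun i : Fin N => ((i : ℕ) : ℝ)).det : ℝ) : ℂ) := by
      rw [Matrix.det_vandermonde, Matrix.det_vandermonde]; push_cast; rfl
    have hv2 : (Matrix.vandermonde fun i => (m i : ℂ)).det =
        (((Matrix.vandermonde fun i => (n i : ℝ)).det : ℝ) : ℂ) := by
      rw [Matrix.det_vandermonde, Matrix.det_vandermonde]; push_cast
      refine Finset.prod_congr rfl fun i _ => Finset.prod_congr rfl fun j _ => ?_
      rw [hm, hm]; push_cast; ring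
    rw [hv1, hv2] at h
    rw [vandermondeRatio, Complex.ofReal_div, eq_div_iff (by exact_mod_cast hv), ← h]
    simp
  · refine ⟨∑ d ∈ (schurDet (fun l : Fin N => (MvPolynomial.X l : MvPolynomial (Fin N) ℂ)) m).support,
      ‖(schurDet (fun l : Fin N => (MvPolynomial.X l : MvPolynomial (Fin N) ℂ)) m).coeff d‖,
      fun x => ?_⟩
    have h1 : ∀ l, ‖Complex.exp (Complex.I * x l)‖ = 1 := fun l => by
      rw [Complex.norm_exp]; simp
    simp only [norm_mul, norm_pow, norm_inv, norm_prod, h1, Finset.prod_const_one, inv_one, one_pow,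
      one_mul, hX]
    exact MvPolynomial.norm_eval_le _ h1

/-! ### Characters are eigenfunctions of the generator. -/

theorem partialDeriv_update {N : ℕ} {F : Type*} [NormedAddCommGroup F] [NormedSpace ℝ F]
    (j : Fin N) (f : (Fin N → ℝ) → F) (x : Fin N → ℝ) (s : ℝ) :
    partialDeriv j f (Function.update x j s) = deriv (fun s => f (Function.update x j s)) s := by
  simp [partialDeriv]

theorem partialDeriv_partialDeriv {N : ℕ} {F : Type*} [NormedAddCommGroup F] [NormedSpace ℝ F]
    (j : Fin N) (f : (Fin N → ℝ) → F) (x : Fin N → ℝ) :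
    partialDeriv j (partialDeriv j f) x =
      deriv (deriv fun s => f (Function.update x j s)) (x j) := by
  rw [partialDeriv]
  simp only [partialDeriv_update]

theorem deriv_deriv_mul {u v : ℝ → ℂ} (hu : ContDiff ℝ ∞ u) (hv : ContDiff ℝ ∞ v) (s : ℝ) :
    deriv (deriv fun s => u s * v s) s =
      deriv (deriv u) s * v s + 2 * (deriv u s * deriv v s) + u s * deriv (deriv v) s := by
  have hu1 : Differentiable ℝ u := hu.differentiable (by simp)
  have hv1 : Differentiable ℝ v := hv.differentiable (by simp)
  have hu2 : Differentiable ℝ (deriv u) :=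
    ((contDiff_infty_iff_deriv.1 hu).2).differentiable (by simp)
  have hv2 : Differentiable ℝ (deriv v) :=
    ((contDiff_infty_iff_deriv.1 hv).2).differentiable (by simp)
  have h1 : (deriv fun s => u s * v s) = fun s => deriv u s * v s + u s * deriv v s :=
    funext fun s => deriv_fun_mul (hu1 s) (hv1 s)
  rw [h1, deriv_fun_add ((hu2 s).fun_mul (hv1 s)) ((hu1 s).fun_mul (hv2 s)),
    deriv_fun_mul (hu2 s) (hv1 s), deriv_fun_mul (hu1 s) (hv2 s)]
  ring

/-- The coefficients `c` are arbitrary so that the formula can be applied twice. -/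
theorem partialDeriv_sum_exp (N : ℕ) (n : Fin N → ℤ) (c : Equiv.Perm (Fin N) → ℂ) (j : Fin N) :
    partialDeriv j (fun x : Fin N → ℝ => ∑ σ : Equiv.Perm (Fin N), c σ *
      Complex.exp (Complex.I * ∑ i, (((n i : ℂ) - ((N : ℂ) - 1) / 2) * x (σ i)))) =
    fun x : Fin N → ℝ => ∑ σ : Equiv.Perm (Fin N),
      (c σ * (Complex.I * ((n (σ.symm j) : ℂ) - ((N : ℂ) - 1) / 2))) *
      Complex.exp (Complex.I * ∑ i, (((n i : ℂ) - ((N : ℂ) - 1) / 2) * x (σ i))) := by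
  funext x
  refine HasDerivAt.deriv ?_
  refine HasDerivAt.fun_sum fun σ _ => ?_
  have hphase : HasDerivAt (fun s : ℝ => Complex.I * ∑ i, (((n i : ℂ) - ((N : ℂ) - 1) / 2) *
      ((Function.update x j s (σ i) : ℝ) : ℂ)))
      (Complex.I * ((n (σ.symm j) : ℂ) - ((N : ℂ) - 1) / 2)) (x j) := by
    have h := HasDerivAt.fun_sum (u := Finset.univ) (x := x j)
      (A := fun i (s : ℝ) => ((n i : ℂ) - ((N : ℂ) - 1) / 2) *
        ((Function.update x j s (σ i) : ℝ) : ℂ))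
      (A' := fun i => if i = σ.symm j then ((n i : ℂ) - ((N : ℂ) - 1) / 2) else 0) (by
        intro i _
        by_cases hi : i = σ.symm j
        · have : σ i = j := by rw [hi]; simp
          simp only [this, Function.update_self, if_pos hi]
          simpa using (Complex.ofRealCLM.hasDerivAt (x := x j)).const_mul
            ((n i : ℂ) - ((N : ℂ) - 1) / 2)
        · have : σ i ≠ j := fun h => hi (by rw [← h]; simp)
          simp only [Function.update_of_ne this, if_neg hi]
          exact hasDerivAt_const _ _)
    have h2 := h.const_mul Complex.I
    simpa using h2
  have h := hphase.cexp.const_mul (c σ)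
  refine h.congr_deriv ?_
  rw [Function.update_eq_self]
  ring

theorem sum_partialDeriv_partialDeriv_alternant (N : ℕ) (n : Fin N → ℤ) (x : Fin N → ℝ) :
    ∑ j, partialDeriv j (partialDeriv j (alternant N n)) x =
      -((∑ j, ((n j : ℂ) - ((N : ℂ) - 1) / 2) ^ 2) * alternant N n x) := by
  have h : alternant N n = fun x => _ := funext (alternant_eq_sum N n)
  rw [h]
  simp only [partialDeriv_sum_exp]
  rw [Finset.sum_comm, Finset.mul_sum, ← Finset.sum_neg_distrib]
  refine Finset.sum_congr rfl fun σ _ => ?_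
  rw [← Equiv.sum_comp σ.symm fun j => ((n j : ℂ) - ((N : ℂ) - 1) / 2) ^ 2, Finset.sum_mul,
    ← Finset.sum_neg_distrib]
  refine Finset.sum_congr rfl fun j _ => ?_
  linear_combination ((Equiv.Perm.sign σ : ℤ) : ℂ) *
    ((n (σ.symm j) : ℂ) - ((N : ℂ) - 1) / 2) ^ 2 *
    Complex.exp (Complex.I * ∑ i, (((n i : ℂ) - ((N : ℂ) - 1) / 2) * x (σ i))) * Complex.I_mul_I

theorem contDiff_update_apply {N : ℕ} (x : Fin N → ℝ) (j l : Fin N) :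
    ContDiff ℝ ∞ fun s : ℝ => Function.update x j s l :=
  contDiff_pi.1 (contDiff_update ∞ x j) l

theorem contDiff_sinProd_update {N : ℕ} (x : Fin N → ℝ) (j : Fin N) :
    ContDiff ℝ ∞ fun s : ℝ => sinProd N (Function.update x j s) :=
  contDiff_prod fun a _ => contDiff_prod fun b _ =>
    (((contDiff_update_apply x j b).sub (contDiff_update_apply x j a)).div_const 2).sin

theorem sinProd_ne_zero {N : ℕ} {x : Fin N → ℝ}
    (hx : Function.Injective fun j : Fin N => Complex.exp (Complex.I * x j)) :
    sinProd N x ≠ 0 := by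
  intro h
  have h1 := alternant_trivialWeight N x
  rw [h, alternant_trivialWeight_eq_vandermonde,
    ← Matrix.det_vandermonde fun l => Complex.exp (Complex.I * x l)] at h1
  simp only [Complex.ofReal_zero, mul_zero, mul_eq_zero, Complex.exp_ne_zero, false_or] at h1
  exact Matrix.det_vandermonde_ne_zero_iff.2 hx h1

theorem dysonPotential_eq {N : ℕ} {x : Fin N → ℝ} (hx : sinProd N x ≠ 0) :
    dysonPotential N x =
      -((∑ j : Fin N, ∑ _k ∈ Finset.Ioi j, Real.log 2) + Real.log (sinProd N x)) := by
  have h0 : ∀ j : Fin N, ∏ k ∈ Finset.Ioi j, Real.sin ((x k - x j) / 2) ≠ 0 := fun j =>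
    Finset.prod_ne_zero_iff.1 hx j (Finset.mem_univ j)
  rw [dysonPotential, sinProd, Real.log_prod fun j _ => h0 j, ← Finset.sum_add_distrib]
  congr 1
  refine Finset.sum_congr rfl fun j _ => ?_
  have h1 := Finset.prod_ne_zero_iff.1 (h0 j)
  rw [Real.log_prod h1, ← Finset.sum_add_distrib]
  refine Finset.sum_congr rfl fun k hk => ?_
  rw [exp_sub_exp_eq_sin, norm_mul, norm_mul, norm_mul, Complex.norm_I, Complex.norm_two, mul_one]
  have e1 : ‖Complex.exp (Complex.I * (((x k : ℂ) + x j) / 2))‖ = 1 := by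
    rw [Complex.norm_exp]
    simp
  have e2 : Complex.sin (((x k : ℂ) - x j) / 2) = ((Real.sin ((x k - x j) / 2) : ℝ) : ℂ) := by
    push_cast; rfl
  rw [e1, e2, mul_one, Complex.norm_real, Real.log_mul two_ne_zero (norm_ne_zero_iff.2 (h1 k hk)),
    Real.norm_eq_abs, Real.log_abs]

/-- Away from collisions the potential is minus the logarithm of the modulus of the denominator
alternant, up to a constant. -/
theorem partialDeriv_dysonPotential_mul {N : ℕ} {x : Fin N → ℝ} (hx : sinProd N x ≠ 0)
    (j : Fin N) :
    ((partialDeriv j (dysonPotential N) x : ℝ) : ℂ) * alternant N (trivialWeight N) x =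
      -partialDeriv j (alternant N (trivialWeight N)) x := by
  have hc := contDiff_sinProd_update x j
  have hd : HasDerivAt (fun s : ℝ => sinProd N (Function.update x j s))
      (deriv (fun s : ℝ => sinProd N (Function.update x j s)) (x j)) (x j) :=
    (hc.differentiable (by simp) _).hasDerivAt
  set D := deriv (fun s : ℝ => sinProd N (Function.update x j s)) (x j)
  have h1 : partialDeriv j (dysonPotential N) x = -(D / sinProd N x) := by
    have hev : (fun s : ℝ => dysonPotential N (Function.update x j s)) =ᶠ[𝓝 (x j)]
        fun s => -((∑ j : Fin N, ∑ _k ∈ Finset.Ioi j, Real.log 2) +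
          Real.log (sinProd N (Function.update x j s))) := by
      have hne : ∀ᶠ s in 𝓝 (x j), sinProd N (Function.update x j s) ≠ 0 :=
        hc.continuous.continuousAt.eventually_ne (by rwa [Function.update_eq_self])
      filter_upwards [hne] with s hs using dysonPotential_eq hs
    rw [partialDeriv, hev.deriv_eq]
    have := ((hd.log (by rwa [Function.update_eq_self])).const_add
      (∑ j : Fin N, ∑ _k ∈ Finset.Ioi j, Real.log 2)).fun_neg
    rw [this.deriv, Function.update_eq_self]
  have h2 : partialDeriv j (alternant N (trivialWeight N)) x =
      (∏ j : Fin N, ∏ _k ∈ Finset.Ioi j, (2 * Complex.I)) * (D : ℂ) := by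
    rw [partialDeriv]
    simp only [alternant_trivialWeight]
    exact (hd.ofReal_comp.const_mul _).deriv
  have hxc : (sinProd N x : ℂ) ≠ 0 := by exact_mod_cast hx
  rw [h1, h2, alternant_trivialWeight]
  push_cast
  field_simp

/-- With `V` the denominator alternant and `∂W = -∂V / V`, the product rule gives `V · 𝓛f = ½ (Δ(fV)
- f ΔV)`. Both `fV` and `V` are alternants, hence eigenfunctions of the Laplacian. -/
theorem dysonGenerator_character {N : ℕ} {n : Fin N → ℤ} {f : (Fin N → ℝ) → ℂ}
    (hf : ContDiff ℝ ∞ f)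
    (h : ∀ x, f x * alternant N (trivialWeight N) x = alternant N n x) {x : Fin N → ℝ}
    (hx : Function.Injective fun j : Fin N => Complex.exp (Complex.I * x j)) :
    dysonGenerator N f x = -(1 / 2) * ((∑ j, (((n j : ℝ) - ((N : ℝ) - 1) / 2) ^ 2 -
      (((j : ℕ) : ℝ) - ((N : ℝ) - 1) / 2) ^ 2) : ℝ) : ℂ) * f x := by
  have hs := sinProd_ne_zero hx
  have hV : alternant N (trivialWeight N) x ≠ 0 := by
    rw [alternant_trivialWeight]
    exact mul_ne_zero (two_I_constant_ne_zero N) (by exact_mod_cast hs)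
  refine mul_right_cancel₀ hV ?_
  have key : ∀ j, (-((partialDeriv j (dysonPotential N) x : ℝ) : ℂ) * partialDeriv j f x
      + (1 / 2) * partialDeriv j (partialDeriv j f) x) * alternant N (trivialWeight N) x =
      (1 / 2) * partialDeriv j (partialDeriv j (alternant N n)) x -
      (1 / 2) * (f x * partialDeriv j (partialDeriv j (alternant N (trivialWeight N))) x) := by
    intro j
    have hu : ContDiff ℝ ∞ fun s : ℝ => f (Function.update x j s) :=
      hf.comp (contDiff_update ∞ x j)
    have hv : ContDiff ℝ ∞ fun s : ℝ => alternant N (trivialWeight N) (Function.update x j s) := by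
      simp only [alternant_trivialWeight]
      exact contDiff_const.mul (Complex.ofRealCLM.contDiff.comp (contDiff_sinProd_update x j))
    have h1 := deriv_deriv_mul hu hv (x j)
    simp only [h, ← partialDeriv_partialDeriv j, Function.update_eq_self] at h1
    have h2 := partialDeriv_dysonPotential_mul hs j
    have h3 : deriv (fun s : ℝ => f (Function.update x j s)) (x j) = partialDeriv j f x := rfl
    have h4 : deriv (fun s : ℝ => alternant N (trivialWeight N) (Function.update x j s)) (x j) =
      partialDeriv j (alternant N (trivialWeight N)) x := rfl
    rw [h3, h4] at h1
    linear_combination (-(1 / 2 : ℂ)) * h1 - partialDeriv j f x * h2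
  rw [dysonGenerator, Finset.sum_mul]
  simp only [key]
  rw [Finset.sum_sub_distrib, ← Finset.mul_sum, ← Finset.mul_sum, ← Finset.mul_sum,
    sum_partialDeriv_partialDeriv_alternant, sum_partialDeriv_partialDeriv_alternant, ← h]
  simp only [trivialWeight]
  push_cast
  rw [Finset.sum_sub_distrib]
  ring

/-! ### Averages over the Dyson law, and the conclusion. -/

/-- The solution of `y' = c y` on `(0, ∞)` with initial limit `y₀`. -/
theorem eq_mul_exp_of_hasDerivAt {y : ℝ → ℂ} {c y₀ : ℂ} (hy : ∀ s, 0 < s → HasDerivAt y (c * y s) s)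
    (h0 : Tendsto y (𝓝[>] 0) (𝓝 y₀)) {t : ℝ} (ht : 0 < t) : y t = y₀ * Complex.exp (c * t) := by
  have hg : ∀ s ∈ Set.Ioi (0 : ℝ), HasDerivAt (fun s : ℝ => y s * Complex.exp (-c * s)) 0 s := by
    intro s hs
    have h1 : HasDerivAt (fun s : ℝ => Complex.exp (-c * s)) (Complex.exp (-c * s) * (-c)) s := by
      simpa using ((Complex.ofRealCLM.hasDerivAt (x := s)).const_mul (-c)).cexp
    exact ((hy s hs).mul h1).congr_deriv (by ring)
  have hconst : ∀ s ∈ Set.Ioi (0 : ℝ), y s * Complex.exp (-c * s) = y t * Complex.exp (-c * t) :=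
    fun s hs => isOpen_Ioi.is_const_of_deriv_eq_zero isPreconnected_Ioi
      (fun u hu => (hg u hu).differentiableAt.differentiableWithinAt)
      (fun u hu => (hg u hu).deriv) hs ht
  have hlim : Tendsto (fun s : ℝ => y s * Complex.exp (-c * s)) (𝓝[>] 0) (𝓝 y₀) := by
    have : Tendsto (fun s : ℝ => Complex.exp (-c * s)) (𝓝[>] 0) (𝓝 1) := by
      have hcont : Continuous fun s : ℝ => Complex.exp (-c * s) := by fun_prop
      have := (hcont.tendsto 0).mono_left (nhdsWithin_le_nhds (s := Set.Ioi 0))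
      simpa using this
    simpa using h0.mul this
  have heq : y₀ = y t * Complex.exp (-c * t) := by
    refine tendsto_nhds_unique hlim (tendsto_const_nhds.congr' ?_)
    filter_upwards [self_mem_nhdsWithin] with s hs using (hconst s hs).symm
  rw [heq, mul_assoc, ← Complex.exp_add]
  simp

theorem dysonQ_rpow (N : ℕ) (t Λ : ℝ) : ((dysonQ N t ^ Λ : ℝ) : ℂ) =
    Complex.exp ((1 / N : ℂ) * (-(1 / 2) * (Λ : ℂ)) * t) := by
  rw [dysonQ, ← Real.exp_mul, Complex.ofReal_exp]
  congr 1
  push_cast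
  rw [div_mul_eq_div_div]
  ring

theorem integral_dysonLaw_eq_sum {N : ℕ} {μ : ℝ → Measure (Fin N → ℝ)} (hμ : IsDysonLaw N μ)
    {t : ℝ} (ht : 0 < t) (f : (Fin N → ℝ) → ℂ) {ι : Type*} (s : Finset ι) (w : ι → Fin N → ℤ)
    (h : ∀ x, f x * alternant N (trivialWeight N) x = ∑ i ∈ s, alternant N (w i) x) :
    ∫ x, f x ∂μ t = ((∑ i ∈ s, charAverage N t (w i) : ℝ) : ℂ) := by
  choose χ hχ hχA hχ0 C hC using fun i => exists_character N (w i)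
  have hchar : ∀ i, ∫ x, χ i x ∂μ t = (charAverage N t (w i) : ℂ) := by
    intro i
    have hy : ∀ u, 0 < u → HasDerivAt (fun u => ∫ x, χ i x ∂μ u)
        ((1 / N : ℂ) * (-(1 / 2) * ((∑ j, (((w i j : ℝ) - ((N : ℝ) - 1) / 2) ^ 2 -
          (((j : ℕ) : ℝ) - ((N : ℝ) - 1) / 2) ^ 2) : ℝ) : ℂ)) * ∫ x, χ i x ∂μ u) u := by
      intro u hu
      refine (hμ.weakEq _ (hχ i) u hu).congr_deriv ?_
      rw [mul_assoc]
      refine congrArg _ (Eq.trans (integral_congr_ae ?_) (integral_const_mul _ _))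
      filter_upwards [hμ.noncolliding u hu] with x hx
      exact dysonGenerator_character (hχ i).smooth (hχA i) hx
    refine (eq_mul_exp_of_hasDerivAt hy (hμ.tendsto_initial _ (hχ i)) ht).trans ?_
    rw [hχ0, charAverage,
      Complex.ofReal_mul, dysonQ_rpow]
  have := hμ.prob t ht
  -- The hypothesis on `f` determines it only where the denominator alternant is nonzero, which is
  -- almost everywhere by the absence of collisions.
  have hae : f =ᵐ[μ t] fun x => ∑ i ∈ s, χ i x := by
    filter_upwards [hμ.noncolliding t ht] with x hx
    have hV : alternant N (trivialWeight N) x ≠ 0 := by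
      rw [alternant_trivialWeight]
      exact mul_ne_zero (two_I_constant_ne_zero N) (by exact_mod_cast sinProd_ne_zero hx)
    refine mul_right_cancel₀ hV ?_
    rw [h, Finset.sum_mul]
    exact Finset.sum_congr rfl fun i _ => (hχA i x).symm
  rw [integral_congr_ae hae, integral_finsetSum]
  · simp only [hchar]
    push_cast
    rfl
  · intro i _
    exact Integrable.of_bound (hχ i).smooth.continuous.aestronglyMeasurable (C i)
      (ae_of_all _ (hC i))

/-- At time 0 all angles coincide and the alternants may not be divided out; the value is recovered
by continuity along a ray of distinct angles. -/
theorem apply_zero_eq_sum {N : ℕ} {f : (Fin N → ℝ) → ℂ} (hf : Continuous f) {ι : Type*}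
    (s : Finset ι) (w : ι → Fin N → ℤ)
    (h : ∀ x, f x * alternant N (trivialWeight N) x = ∑ i ∈ s, alternant N (w i) x) :
    f 0 = ((∑ i ∈ s, charAverage N 0 (w i) : ℝ) : ℂ) := by
  choose χ hχ hχA hχ0 C hC using fun i => exists_character N (w i)
  have hc : ∀ n, charAverage N 0 n = vandermondeRatio N n := by
    intro n; simp [charAverage, dysonQ]
  simp only [hc]
  push_cast
  simp only [← hχ0]
  have hray : Continuous fun ε : ℝ => fun j : Fin N => ε * ((j : ℕ) : ℝ) := by fun_prop
  have hray0 : (fun j : Fin N => (0 : ℝ) * ((j : ℕ) : ℝ)) = 0 := by funext j; simp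
  have h1 : Tendsto (fun ε : ℝ => f fun j => ε * ((j : ℕ) : ℝ)) (𝓝[>] 0) (𝓝 (f 0)) := by
    have := ((hf.comp hray).tendsto 0).mono_left (nhdsWithin_le_nhds (s := Set.Ioi 0))
    simpa only [Function.comp_def, hray0] using this
  have hχc : Continuous fun x => ∑ i ∈ s, χ i x :=
    continuous_finsetSum _ fun i _ => (hχ i).smooth.continuous
  have h2 : Tendsto (fun ε : ℝ => ∑ i ∈ s, χ i fun j => ε * ((j : ℕ) : ℝ)) (𝓝[>] 0)
      (𝓝 (∑ i ∈ s, χ i 0)) := by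
    have := ((hχc.comp hray).tendsto 0).mono_left (nhdsWithin_le_nhds (s := Set.Ioi 0))
    simpa only [Function.comp_def, hray0] using this
  refine tendsto_nhds_unique h1 (h2.congr' ?_)
  -- For such `ε` all half-differences along the ray lie in `(0, π)`, so no sine vanishes.
  have hpos : (0 : ℝ) < Real.pi / (N + 1) := by positivity
  filter_upwards [Ioo_mem_nhdsGT hpos] with ε hε
  have hsin : sinProd N (fun j => ε * ((j : ℕ) : ℝ)) ≠ 0 := by
    refine Finset.prod_ne_zero_iff.2 fun a _ => Finset.prod_ne_zero_iff.2 fun b hb => ?_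
    have hab : ((a : ℕ) : ℝ) < (b : ℕ) := by exact_mod_cast Finset.mem_Ioi.1 hb
    have hbN : ((b : ℕ) : ℝ) < N := by exact_mod_cast b.2
    have ha : (0 : ℝ) ≤ (a : ℕ) := by positivity
    have hε2 := (lt_div_iff₀ (by positivity)).1 hε.2
    refine (Real.sin_pos_of_pos_of_lt_pi ?_ ?_).ne'
    · nlinarith [hε.1]
    · nlinarith [hε.1]
  have hV : alternant N (trivialWeight N) (fun j => ε * ((j : ℕ) : ℝ)) ≠ 0 := by
    rw [alternant_trivialWeight]
    exact mul_ne_zero (two_I_constant_ne_zero N) (by exact_mod_cast hsin)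
  refine mul_right_cancel₀ hV ?_
  rw [h, Finset.sum_mul]
  exact Finset.sum_congr rfl fun i _ => hχA i _

theorem spectralFormFactor_dysonLaw {N : ℕ} {μ : ℝ → Measure (Fin N → ℝ)} (hμ : IsDysonLaw N μ)
    {t : ℝ} (ht : 0 ≤ t) (k : ℕ) :
    spectralFormFactor (fun f => ∫ x, f x ∂μ t) k = (formFactorSum N t k : ℂ) := by
  rcases ht.eq_or_lt with rfl | ht
  -- For the point mass the observables must be restricted to continuous ones; at positive times
  -- every function is admitted.
  · refine spectralFormFactor_eq N 0 k _ {f | Continuous f} ?_ (fun m => ?_) ?_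
    · change Continuous _; fun_prop
    · change Continuous _; fun_prop
    · intro f hf _ s w h
      simp only [hμ.initial, integral_dirac]
      exact apply_zero_eq_sum hf s w h
  · exact spectralFormFactor_eq N t k _ Set.univ trivial (fun _ => trivial)
      fun f _ _ s w h => integral_dysonLaw_eq_sum hμ ht f s w h

theorem mainTheorem7 (N : ℕ) (hN : 1 ≤ N) :
    -- the coefficients that do not vanish
    (∀ t : ℝ, 0 ≤ t →
      (∀ j : ℤ, coeffA N t j ≠ 0 ↔ 0 ≤ j ∧ j ≤ (N : ℤ) - 1) ∧
      (∀ l : ℤ, coeffB N t l ≠ 0 ↔ ¬ (0 ≤ l ∧ l ≤ (N : ℤ) - 1))) ∧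
    -- the form factor of the ensemble with the explicit eigenvalue density
    (∀ t : ℝ, 0 < t → ∀ k : ℕ,
      spectralFormFactor (dysonAverage N t) k = (formFactorSum N t k : ℂ)) ∧
    -- the form factor of Dyson Brownian motion from the identity
    (∀ μ : ℝ → Measure (Fin N → ℝ), IsDysonLaw N μ → ∀ t : ℝ, 0 ≤ t → ∀ k : ℕ,
      spectralFormFactor (fun f => ∫ x, f x ∂μ t) k = (formFactorSum N t k : ℂ)) :=
  ⟨fun t _ => ⟨coeffA_ne_zero_iff N t, coeffB_ne_zero_iff N t⟩,
    fun _ ht k => spectralFormFactor_dysonAverage hN ht k,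
    fun _ hμ _ ht k => spectralFormFactor_dysonLaw hμ ht k⟩
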